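/- Let $G=SO(5)$ and let $H=SO(2)\times SO(2)\times SO(1)\subset G$ be embedded as block-diagonal matrices. Write a general element of $\mathfrak{so}(5)$ as $$\begin{pmatrix} 0&x_1&a_1&a_2&b_1\\ -x_1&0&a_3&a_4&b_2\\ -a_1&-a_3&0&x_2&c_1\\ -a_2&-a_4&-x_2&0&c_2\\ -b_1&-b_2&-c_1&-c_2&0\end{pmatrix},$$ and let $\mathfrak g_e,\mathfrak g_a,\mathfrak g_b,\mathfrak g_c$ be the subspaces on which only the entries $x_i$, respectively $a_i$, $b_i$, $c_i$, may be nonzero. Thus $\mathfrak{so}(5)=\mathfrak g_e\oplus\mathfrak m$ with $\mathfrak g_e=\mathrm{Lie}(H)$ and $\mathfrak m=\mathfrak g_a\oplus\mathfrak g_b\oplus\mathfrak g_c\cong T_{eH}(G/H)$. Let $\alpha_1,\dots,\alpha_4,\beta_1,\beta_2,\gamma_1,\gamma_2$ be the linear forms on $\mathfrak m$ giving the entries $a_1,\dots,a_4,b_1,b_2,c_1,c_2$. Let $g$ be a $G$-invariant metric on $M=G/H$ (Riemannian, or more generally pseudo-Riemannian), given by the $\mathrm{Ad}(H)$-invariant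 nondegenerate symmetric bilinear form $B$ on $\mathfrak m$, and assume that $\mathfrak g_a,\mathfrak g_b,\mathfrak g_c$ are pairwise $B$-orthogonal. Let $\nabla$ be the canonical connection of the reductive homogeneous space $G/H$, that is, the connection induced on $TM=G\times_H\mathfrak m$ by the principal connection on $G\to G/H$ given by the $\mathfrak g_e$-component of the canonical 1-form of $G$. Let $T$ be its torsion, $T(X,Y)_{eH}=-[X,Y]_{\mathfrak m}$, and let $\overline\nabla=\nabla-\tfrac12T$ be the torsion-free canonical connection. Then $g$ has exactly one Levi-Civita connection $\nabla_g$ (torsion-free connection for which $g$ is parallel), and $\nabla_g=\overline\nabla$ if and only if $$B=c\Big(\sum_{i=1}^4\alpha_i^2+\sum_{i=1}^2\beta_i^2+\sum_{i=1}^2\gamma_i^2\Big)$$ for some real $c\neq0$; if $g$ is Riemannian, the condition is the same with $c>0$. Moreover, there are real numbers $t,u,v,w$ with $$B=t\sum_{i=1}^4\alpha_i^2+u(\alpha_1\alpha_4-\alpha_2\alpha_3)+v\sum_{i=1}^2\beta_i^2+w\sum_{i=1}^2\gamma_i^2;$$ the metric $g$ is naturally reductive, i.e. $B(X,[Z,Y]_{\mathfrak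 m})+B([Z,X]_{\mathfrak m},Y)=0$ for all $X,Y,Z\in\mathfrak m$, if and only if $u=0$ and $t=v=w$, and this condition is also equivalent to $\nabla_g=\overline\nabla$. -/

import Mathlib

open scoped Matrix ContDiff

namespace FlagSO5

noncomputable section

/-! ## The group `SO(5)`, the subgroup `SO(2) × SO(2) × SO(1)` and the grading of `so(5)` -/

/-- Real `5 × 5` matrices. -/
abbrev Mat5 : Type := Matrix (Fin 5) (Fin 5) ℝ

/-- The group `SO(5)`. -/
abbrev SO5 : Type := Matrix.specialOrthogonalGroup (Fin 5) ℝ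

/-- The index of the diagonal block (of sizes `2, 2, 1`) containing a given index. -/
def blk : Fin 5 → Fin 3 := ![0, 0, 1, 1, 2]

/-- The block diagonal matrix with blocks `P, Q, R` of sizes `2, 2, 1`. -/
def blockDiag (P Q : Matrix (Fin 2) (Fin 2) ℝ) (R : Matrix (Fin 1) (Fin 1) ℝ) : Mat5 :=
  !![P 0 0, P 0 1, 0, 0, 0;
     P 1 0, P 1 1, 0, 0, 0;
     0, 0, Q 0 0, Q 0 1, 0;
     0, 0, Q 1 0, Q 1 1, 0;
     0, 0, 0, 0, R 0 0]

lemma blockDiag_mul (P Q P' Q' : Matrix (Fin 2) (Fin 2) ℝ) (R R' : Matrix (Fin 1) (Fin 1) ℝ) :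
    blockDiag P Q R * blockDiag P' Q' R' = blockDiag (P * P') (Q * Q') (R * R') := by
  ext i j
  fin_cases i <;> fin_cases j <;>
    simp [blockDiag, Matrix.mul_apply, Fin.sum_univ_succ]

lemma blockDiag_one : blockDiag 1 1 1 = 1 := by
  ext i j
  fin_cases i <;> fin_cases j <;> simp [blockDiag]

lemma blockDiag_transpose (P Q : Matrix (Fin 2) (Fin 2) ℝ) (R : Matrix (Fin 1) (Fin 1) ℝ) :
    (blockDiag P Q R)ᵀ = blockDiag Pᵀ Qᵀ Rᵀ := by
  ext i j
  fin_cases i <;> fin_cases j <;> simp [blockDiag]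

lemma blockDiag_offDiag (P Q : Matrix (Fin 2) (Fin 2) ℝ) (R : Matrix (Fin 1) (Fin 1) ℝ)
    (i j : Fin 5) (h : blk i ≠ blk j) : blockDiag P Q R i j = 0 := by
  fin_cases i <;> fin_cases j <;> simp_all [blockDiag, blk]

lemma coe_inv (g : SO5) : ((g⁻¹ : SO5) : Mat5) = (g : Mat5)ᵀ := rfl

lemma coe_mul_transpose (g : SO5) : (g : Mat5) * (g : Mat5)ᵀ = 1 :=
  (Matrix.mem_orthogonalGroup_iff _ _).1 (Matrix.mem_specialOrthogonalGroup_iff.1 g.2).1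

lemma coe_transpose_mul (g : SO5) : (g : Mat5)ᵀ * (g : Mat5) = 1 :=
  (Matrix.mem_orthogonalGroup_iff' _ _).1 (Matrix.mem_specialOrthogonalGroup_iff.1 g.2).1

/-- The subgroup `H = SO(2) × SO(2) × SO(1)` of `SO(5)`, embedded block diagonally. -/
def H : Subgroup SO5 where
  carrier := {g | ∃ (P Q : Matrix.specialOrthogonalGroup (Fin 2) ℝ)
    (R : Matrix.specialOrthogonalGroup (Fin 1) ℝ), (g : Mat5) = blockDiag P Q R}
  mul_mem' := by
    rintro a b ⟨P, Q, R, h⟩ ⟨P', Q', R', h'⟩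
    refine ⟨P * P', Q * Q', R * R', ?_⟩
    have : ((a * b : SO5) : Mat5) = (a : Mat5) * b := rfl
    rw [this, h, h', blockDiag_mul]
    rfl
  one_mem' := ⟨1, 1, 1, blockDiag_one.symm⟩
  inv_mem' := by
    rintro a ⟨P, Q, R, h⟩
    refine ⟨P⁻¹, Q⁻¹, R⁻¹, ?_⟩
    rw [coe_inv, h, blockDiag_transpose]
    rfl

lemma H_offDiag (h : H) (i j : Fin 5) (hij : blk i ≠ blk j) : ((h : SO5) : Mat5) i j = 0 := by
  obtain ⟨P, Q, R, e⟩ := h.2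
  rw [e]
  exact blockDiag_offDiag _ _ _ i j hij

/-- The complement `𝔪 = g_a ⊕ g_b ⊕ g_c` of the Lie algebra `g_e` of `H` in `so(5)`: the
skew-symmetric matrices whose three diagonal blocks vanish. -/
def 𝔪 : Submodule ℝ Mat5 where
  carrier := {X | Xᵀ = -X ∧ ∀ i j, blk i = blk j → X i j = 0}
  add_mem' := by
    rintro X Y ⟨hX, hX'⟩ ⟨hY, hY'⟩
    refine ⟨by rw [Matrix.transpose_add, hX, hY, neg_add], fun i j hij => ?_⟩
    simp [hX' i j hij, hY' i j hij]
  zero_mem' := by simp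
  smul_mem' := by
    rintro c X ⟨hX, hX'⟩
    refine ⟨by rw [Matrix.transpose_smul, hX, smul_neg], fun i j hij => ?_⟩
    simp [hX' i j hij]

/-- The component `g_a`: only the entries `a₁, a₂, a₃, a₄` (blocks `1` and `2`) may be nonzero. -/
def InGa (X : 𝔪) : Prop := ∀ i j, ¬(i < 2 ∧ 2 ≤ j ∧ j < 4) → i < j → (X : Mat5) i j = 0

/-- The component `g_b`: only the entries `b₁, b₂` (blocks `1` and `3`) may be nonzero. -/
def InGb (X : 𝔪) : Prop := ∀ i j, ¬(i < 2 ∧ j = 4) → i < j → (X : Mat5) i j = 0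

/-- The component `g_c`: only the entries `c₁, c₂` (blocks `2` and `3`) may be nonzero. -/
def InGc (X : 𝔪) : Prop :=
  ∀ i j, ¬(2 ≤ i ∧ i < 4 ∧ j = 4) → i < j → (X : Mat5) i j = 0

/-- The linear map whose restriction to `so(5)` is the projection onto `𝔪` along `g_e`
(it takes the skew-symmetric part and deletes the diagonal blocks). -/
def proj : Mat5 →ₗ[ℝ] 𝔪 where
  toFun A := ⟨Matrix.of fun i j => if blk i = blk j then 0 else (A i j - A j i) / 2, by
    refine ⟨?_, fun i j hij => by simp [hij]⟩
    ext i j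
    by_cases hij : blk i = blk j
    · simp [hij]
    · simp [hij, Ne.symm hij]; ring⟩
  map_add' A B := by
    ext i j
    by_cases hij : blk i = blk j
    · simp [hij]
    · simp [hij]; ring
  map_smul' c A := by
    ext i j
    by_cases hij : blk i = blk j
    · simp [hij]
    · simp [hij]; ring

lemma conj_mem (h : H) (X : 𝔪) :
    ((h : SO5) : Mat5) * (X : Mat5) * ((h : SO5) : Mat5)ᵀ ∈ 𝔪 := by
  obtain ⟨hX, hX'⟩ := X.2
  refine ⟨?_, fun i j hij => ?_⟩
  · simp only [Matrix.transpose_mul, Matrix.transpose_transpose, hX]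
    simp [Matrix.mul_assoc]
  · rw [Matrix.mul_apply]
    refine Finset.sum_eq_zero fun k _ => ?_
    by_cases hk : blk j = blk k
    · rw [Matrix.mul_apply, Finset.sum_eq_zero, zero_mul]
      intro l _
      by_cases hl : blk i = blk l
      · rw [hX' l k (by rw [← hl, hij, hk]), mul_zero]
      · rw [H_offDiag h i l hl, zero_mul]
    · rw [Matrix.transpose_apply, H_offDiag h j k hk, mul_zero]

/-- The adjoint action `X ↦ h X h⁻¹` of `H` on `𝔪`. -/
def Ad (h : H) : 𝔪 →ₗ[ℝ] 𝔪 where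
  toFun X := ⟨((h : SO5) : Mat5) * (X : Mat5) * (((h : SO5)⁻¹ : SO5) : Mat5), conj_mem h X⟩
  map_add' X Y := by ext1; simp [mul_add, add_mul]
  map_smul' c X := by ext1; simp

/-- The bracket `[X, Y]_𝔪`, the `𝔪`-component of the commutator of `X, Y ∈ 𝔪`. -/
def bracketM (X Y : 𝔪) : 𝔪 := proj ((X : Mat5) * (Y : Mat5) - (Y : Mat5) * (X : Mat5))

attribute [local instance] Matrix.linftyOpNormedRing Matrix.linftyOpNormedAlgebra
  Matrix.linftyOpNormedAddCommGroup Matrix.linftyOpNormedSpace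

/-- The exponential map `𝔪 → SO(5)`. -/
def expSO (X : 𝔪) : SO5 := ⟨NormedSpace.exp (X : Mat5), by
  have key : ∀ Y : 𝔪, NormedSpace.exp (Y : Mat5) * (NormedSpace.exp (Y : Mat5))ᵀ = 1 := by
    intro Y
    rw [← Matrix.exp_transpose, Y.2.1, ← Matrix.exp_add_of_commute _ _
      (show Commute (Y : Mat5) (-(Y : Mat5)) by simp [Commute, SemiconjBy])]
    simp
  refine Matrix.mem_specialOrthogonalGroup_iff.2
    ⟨(Matrix.mem_orthogonalGroup_iff _ _).2 (key X), ?_⟩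
  have hs : NormedSpace.exp (X : Mat5) =
      NormedSpace.exp (((1 / 2 : ℝ) • X : 𝔪) : Mat5) *
        NormedSpace.exp (((1 / 2 : ℝ) • X : 𝔪) : Mat5) := by
    rw [← Matrix.exp_add_of_commute _ _ (Commute.refl _), ← Submodule.coe_add, ← add_smul]
    norm_num
  have hd := congrArg Matrix.det (key ((1 / 2 : ℝ) • X))
  rw [Matrix.det_mul, Matrix.det_transpose, Matrix.det_one] at hd
  rw [hs, Matrix.det_mul, hd]⟩

/-! ## Smooth functions and vector fields on `M = SO(5)/H` -/

/-- A map on `SO(5)`, a closed submanifold of the space of matrices, is smooth if it is the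
restriction of a smooth map on the space of matrices. -/
def IsSmooth {E : Type} [NormedAddCommGroup E] [NormedSpace ℝ E] (F : SO5 → E) : Prop :=
  ∃ F' : Mat5 → E, ContDiff ℝ ∞ F' ∧ ∀ g : SO5, F g = F' (g : Mat5)

lemma Ad_inv_exp (h : H) (X : 𝔪) (g : SO5) :
    g * (h : SO5) * expSO (Ad h⁻¹ X) = g * expSO X * (h : SO5) := by
  have : expSO (Ad h⁻¹ X) = (h : SO5)⁻¹ * expSO X * (h : SO5) := by
    apply Subtype.ext
    change NormedSpace.exp ((((h⁻¹ : H) : SO5) : Mat5) * (X : Mat5) * ((((h⁻¹ : H) : SO5)⁻¹ : SO5) : Mat5)) = (((h : SO5)⁻¹ : SO5) : Mat5) * NormedSpace.exp (X : Mat5) * ((h : SO5) : Mat5)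
    have e : ((((h⁻¹ : H) : SO5)⁻¹ : SO5) : Mat5) = ((((h⁻¹ : H) : SO5)) : Mat5)⁻¹ := by
      symm
      apply Matrix.inv_eq_right_inv
      exact coe_mul_transpose _
    have hu : IsUnit ((((h⁻¹ : H) : SO5)) : Mat5) :=
      IsUnit.of_mul_eq_one _ (coe_mul_transpose _)
    rw [e, Matrix.exp_conj _ _ hu, ← e]
    simp
  rw [this]
  group

lemma IsSmooth.add {E : Type} [NormedAddCommGroup E] [NormedSpace ℝ E] {F G : SO5 → E}
    (hF : IsSmooth F) (hG : IsSmooth G) : IsSmooth (fun g => F g + G g) := by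
  obtain ⟨F', h1, h2⟩ := hF
  obtain ⟨G', h3, h4⟩ := hG
  exact ⟨fun A => F' A + G' A, h1.add h3, fun g => by simp only [h2, h4]⟩

lemma IsSmooth.smul {E : Type} [NormedAddCommGroup E] [NormedSpace ℝ E] {f : SO5 → ℝ}
    {F : SO5 → E} (hf : IsSmooth f) (hF : IsSmooth F) : IsSmooth (fun g => f g • F g) := by
  obtain ⟨f', h1, h2⟩ := hf
  obtain ⟨F', h3, h4⟩ := hF
  exact ⟨fun A => f' A • F' A, h1.smul h3, fun g => by simp only [h2, h4]⟩

lemma IsSmooth.const {E : Type} [NormedAddCommGroup E] [NormedSpace ℝ E] (c : E) :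
    IsSmooth (fun _ => c) := ⟨fun _ => c, contDiff_const, fun _ => rfl⟩

/-- The algebra `C^∞(M)`: functions on the coset space `M = SO(5)/H` whose pullback to `SO(5)`
is smooth. -/
def SmoothFun : Subalgebra ℝ (SO5 ⧸ H → ℝ) where
  carrier := {f | IsSmooth fun g : SO5 => f (QuotientGroup.mk g)}
  mul_mem' := fun ha hb => ha.smul hb
  add_mem' := fun ha hb => ha.add hb
  algebraMap_mem' := fun r => IsSmooth.const r

/-- The vector fields on `M = SO(5)/H`. The tangent bundle of `M` is the associated bundle
`SO(5) ×_H 𝔪`, the class of `(g, X)` being the velocity at `t = 0` of the curve `g exp(t X) H`;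
thus a smooth vector field is a smooth map `X : SO(5) → 𝔪` with `X(gh) = Ad(h⁻¹) X(g)`. -/
def VectorField : Submodule ℝ (SO5 → 𝔪) where
  carrier := {X | IsSmooth X ∧ ∀ (g : SO5) (h : H), X (g * (h : SO5)) = Ad h⁻¹ (X g)}
  add_mem' := fun ha hb => ⟨ha.1.add hb.1, fun g h => by simp [ha.2 g h, hb.2 g h]⟩
  zero_mem' := ⟨IsSmooth.const 0, fun g h => by simp⟩
  smul_mem' := fun c X hX => ⟨(IsSmooth.const c).smul hX.1, fun g h => by simp [hX.2 g h]⟩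

/-- The vector field `f X`. -/
def fmul (f : SmoothFun) (X : VectorField) : VectorField :=
  ⟨fun g => f.1 (QuotientGroup.mk g) • X.1 g, IsSmooth.smul f.2 X.2.1, fun g h => by
    simp only [X.2.2, map_smul, QuotientGroup.mk_mul_of_mem g h.2]⟩

/-- The derivative at `g` of a map on `SO(5)` along the curve `g exp(t X(g))`, which is the
horizontal lift (tangent to `g 𝔪`) of the vector field `X`. -/
def horDeriv {E : Type} [NormedAddCommGroup E] [NormedSpace ℝ E] (X : SO5 → 𝔪) (F : SO5 → E)
    (g : SO5) : E :=
  deriv (fun t : ℝ => F (g * expSO (t • X g))) 0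

lemma hasDerivAt_hor {E : Type} [NormedAddCommGroup E] [NormedSpace ℝ E] {F : SO5 → E}
    {F' : Mat5 → E} (hF' : ContDiff ℝ ∞ F') (hF : ∀ g : SO5, F g = F' (g : Mat5))
    (g : SO5) (Z : 𝔪) :
    HasDerivAt (fun t : ℝ => F (g * expSO (t • Z))) (fderiv ℝ F' (g : Mat5) ((g : Mat5) * Z)) 0 := by
  have h1 : HasDerivAt (fun t : ℝ => NormedSpace.exp (t • (Z : Mat5))) (Z : Mat5) 0 := by
    have h := hasDerivAt_exp_smul_const (𝕂 := ℝ) (Z : Mat5) (0 : ℝ)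
    rw [zero_smul, NormedSpace.exp_zero, one_mul] at h
    exact h
  have h2 := h1.const_mul (g : Mat5)
  have h3 : HasFDerivAt F' (fderiv ℝ F' (g : Mat5))
      ((g : Mat5) * NormedSpace.exp ((0 : ℝ) • (Z : Mat5))) := by
    simp only [zero_smul, NormedSpace.exp_zero, mul_one]
    exact (hF'.differentiable (by simp) _).hasFDerivAt
  have h4 := h3.comp_hasDerivAt (0 : ℝ) h2
  refine h4.congr_of_eventuallyEq (Filter.Eventually.of_forall fun t => ?_)
  simp only [hF]
  rfl

lemma horDeriv_eq {E : Type} [NormedAddCommGroup E] [NormedSpace ℝ E] {F : SO5 → E}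
    {F' : Mat5 → E} (hF' : ContDiff ℝ ∞ F') (hF : ∀ g : SO5, F g = F' (g : Mat5))
    (X : SO5 → 𝔪) (g : SO5) :
    horDeriv X F g = fderiv ℝ F' (g : Mat5) ((g : Mat5) * X g) :=
  (hasDerivAt_hor hF' hF g (X g)).deriv

lemma isSmooth_horDeriv {E : Type} [NormedAddCommGroup E] [NormedSpace ℝ E] {X : SO5 → 𝔪}
    {F : SO5 → E} (hX : IsSmooth X) (hF : IsSmooth F) : IsSmooth (horDeriv X F) := by
  obtain ⟨X', hX1, hX2⟩ := hX
  obtain ⟨F', hF1, hF2⟩ := hF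
  refine ⟨fun A => fderiv ℝ F' A (A * (X' A : Mat5)), ?_, fun g => ?_⟩
  · have h2 : ContDiff ℝ ∞ fun A => ((X' A : 𝔪) : Mat5) :=
      𝔪.subtypeL.contDiff.comp hX1
    exact ContDiff.fderiv_apply (m := ∞) (n := ∞) (f := fun _ : Mat5 => F')
      (hF1.comp contDiff_snd) contDiff_id (contDiff_id.mul h2) (by simp)
  · rw [horDeriv_eq hF1 hF2, hX2]

lemma horDeriv_mul_right {E : Type} [NormedAddCommGroup E] [NormedSpace ℝ E] (X : VectorField)
    (F : SO5 → E) (g : SO5) (h : H) :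
    horDeriv X.1 F (g * (h : SO5)) =
      deriv (fun t : ℝ => F (g * expSO (t • X.1 g) * (h : SO5))) 0 := by
  unfold horDeriv
  simp only [X.2.2, ← map_smul, Ad_inv_exp]

/-- The action `X f` of a vector field `X` on a smooth function `f` on `M`: at the point `gH` it
is the derivative at `t = 0` of `f (g exp(t X(g)) H)`. -/
def act (X : VectorField) (f : SmoothFun) : SmoothFun :=
  ⟨Quotient.lift (horDeriv X.1 fun g : SO5 => f.1 (QuotientGroup.mk g)) (by
    intro a b hab
    obtain ⟨h, rfl⟩ : ∃ h : H, b = a * (h : SO5) :=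
      ⟨⟨a⁻¹ * b, QuotientGroup.leftRel_apply.1 hab⟩, by simp⟩
    rw [horDeriv_mul_right]
    unfold horDeriv
    simp only [QuotientGroup.mk_mul_of_mem _ h.2]),
   isSmooth_horDeriv X.2.1 f.2⟩

/-! ## Affine connections -/

/-- An affine connection (covariant derivative of vector fields) on `M = SO(5)/H`. -/
@[ext]
structure AffineConnection where
  /-- The vector field `∇_X Y`. -/
  cov : VectorField → VectorField → VectorField
  add_left : ∀ X X' Y, cov (X + X') Y = cov X Y + cov X' Y
  smul_left : ∀ (f : SmoothFun) X Y, cov (fmul f X) Y = fmul f (cov X Y)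
  add_right : ∀ X Y Y', cov X (Y + Y') = cov X Y + cov X Y'
  leibniz : ∀ X (f : SmoothFun) Y,
    cov X (fmul f Y) = fmul (act X f) Y + fmul f (cov X Y)

/-- `T` is the torsion of `D`: `T(X, Y) = D_X Y - D_Y X - [X, Y]`, where the Lie bracket is given
by its action on smooth functions, `[X, Y] f = X (Y f) - Y (X f)`. -/
def AffineConnection.IsTorsion (D : AffineConnection)
    (T : VectorField → VectorField → VectorField) : Prop :=
  ∀ (X Y : VectorField) (f : SmoothFun),
    act (T X Y) f =
      act (D.cov X Y) f - act (D.cov Y X) f - (act X (act Y f) - act Y (act X f))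

/-- The canonical connection of the reductive homogeneous space `SO(5)/H`: the covariant
derivative on `TM = SO(5) ×_H 𝔪` induced by the principal connection on `SO(5) → M` that is the
`g_e`-component of the canonical 1-form (its horizontal spaces are `g 𝔪`), so that
`∇_X Y` is the derivative of `Y : SO(5) → 𝔪` along the horizontal lift of `X`. -/
def canonical : AffineConnection where
  cov X Y := ⟨horDeriv X.1 Y.1, isSmooth_horDeriv X.2.1 Y.2.1, fun g h => by
    rw [horDeriv_mul_right]
    simp only [Y.2.2]
    obtain ⟨Y', hY1, hY2⟩ := Y.2.1
    have h1 := hasDerivAt_hor hY1 hY2 g (X.1 g)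
    have h2 := ((LinearMap.toContinuousLinearMap (Ad h⁻¹)).hasFDerivAt).comp_hasDerivAt (0 : ℝ) h1
    rw [horDeriv, h1.deriv]
    exact h2.deriv⟩
  add_left X X' Y := by
    apply Subtype.ext
    funext g
    obtain ⟨Y', hY1, hY2⟩ := Y.2.1
    change horDeriv (X.1 + X'.1) Y.1 g = horDeriv X.1 Y.1 g + horDeriv X'.1 Y.1 g
    simp only [horDeriv_eq hY1 hY2]
    simp [mul_add]
  smul_left f X Y := by
    apply Subtype.ext
    funext g
    obtain ⟨Y', hY1, hY2⟩ := Y.2.1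
    change horDeriv (fmul f X).1 Y.1 g = f.1 (QuotientGroup.mk g) • horDeriv X.1 Y.1 g
    simp only [horDeriv_eq hY1 hY2]
    simp [fmul]
  add_right X Y Z := by
    apply Subtype.ext
    funext g
    obtain ⟨Y', hY1, hY2⟩ := Y.2.1
    obtain ⟨Z', hZ1, hZ2⟩ := Z.2.1
    change horDeriv X.1 (fun g => Y.1 g + Z.1 g) g = horDeriv X.1 Y.1 g + horDeriv X.1 Z.1 g
    have h1 := hasDerivAt_hor hY1 hY2 g (X.1 g)
    have h2 := hasDerivAt_hor hZ1 hZ2 g (X.1 g)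
    rw [horDeriv, horDeriv, horDeriv, h1.deriv, h2.deriv]
    exact (h1.add h2).deriv
  leibniz X f Y := by
    apply Subtype.ext
    funext g
    obtain ⟨Y', hY1, hY2⟩ := Y.2.1
    obtain ⟨f', hf1, hf2⟩ := f.2
    have h1 := hasDerivAt_hor hY1 hY2 g (X.1 g)
    have h2 := hasDerivAt_hor hf1 hf2 g (X.1 g)
    have h3 := h2.smul h1
    simp only [zero_smul] at h3
    have e : expSO 0 = 1 := Subtype.ext (by simp [expSO])
    rw [e, mul_one] at h3
    change horDeriv X.1 (fmul f Y).1 g =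
      horDeriv X.1 (fun g : SO5 => f.1 (QuotientGroup.mk g)) g • Y.1 g +
        f.1 (QuotientGroup.mk g) • horDeriv X.1 Y.1 g
    rw [horDeriv, horDeriv, horDeriv, h1.deriv, h2.deriv, add_comm]
    exact h3.deriv

/-! ## The torsion-free canonical connection -/

lemma proj_coe (X : 𝔪) : proj (X : Mat5) = X := by
  obtain ⟨hX, hX'⟩ := X.2
  ext i j
  by_cases hij : blk i = blk j
  · simp [proj, hij, hX' i j hij]
  · have : (X : Mat5) j i = -(X : Mat5) i j := congrFun (congrFun hX i) j
    simp [proj, hij, this]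

lemma proj_eq_zero {A : Mat5} (h : ∀ i j, blk i ≠ blk j → A i j = A j i) : proj A = 0 := by
  ext i j
  by_cases hij : blk i = blk j
  · simp [proj, hij]
  · simp [proj, hij, h i j hij]

lemma proj_conj (h : H) (A : Mat5) :
    proj (((h : SO5) : Mat5) * A * ((h : SO5) : Mat5)ᵀ) = Ad h (proj A) := by
  have hD : ∀ i j, blk i ≠ blk j →
      (A - (proj A : Mat5)) i j = (A - (proj A : Mat5)) j i := by
    intro i j hij
    simp [proj, hij, Ne.symm hij]
    ring
  have hsplit : ((h : SO5) : Mat5) * A * ((h : SO5) : Mat5)ᵀ =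
      (Ad h (proj A) : Mat5) +
        ((h : SO5) : Mat5) * (A - (proj A : Mat5)) * ((h : SO5) : Mat5)ᵀ := by
    change _ = ((h : SO5) : Mat5) * (proj A : Mat5) * ((h : SO5) : Mat5)ᵀ + _
    rw [mul_sub, sub_mul]
    abel
  suffices hz : proj (((h : SO5) : Mat5) * (A - (proj A : Mat5)) * ((h : SO5) : Mat5)ᵀ) = 0 by
    rw [hsplit, map_add, proj_coe, hz, add_zero]
  apply proj_eq_zero
  intro i j hij
  have expand : ∀ (D : Mat5) (i j : Fin 5),
      (((h : SO5) : Mat5) * D * ((h : SO5) : Mat5)ᵀ) i j =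
        ∑ k, ∑ l, ((h : SO5) : Mat5) i k * D k l * ((h : SO5) : Mat5) j l := by
    intro D i j
    simp only [Matrix.mul_apply, Matrix.transpose_apply, Finset.sum_mul]
    exact Finset.sum_comm
  rw [expand, expand, Finset.sum_comm]
  refine Finset.sum_congr rfl fun l _ => Finset.sum_congr rfl fun k _ => ?_
  by_cases hk : blk i = blk k
  · by_cases hl : blk j = blk l
    · rw [hD k l (by rw [← hk, ← hl]; exact hij)]
      ring
    · rw [H_offDiag h j l hl]
      ring
  · rw [H_offDiag h i k hk]
    ring

lemma bracketM_add_left (X X' Y : 𝔪) :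
    bracketM (X + X') Y = bracketM X Y + bracketM X' Y := by
  rw [bracketM, bracketM, bracketM, ← map_add, Submodule.coe_add, Matrix.add_mul, Matrix.mul_add]
  congr 1
  abel

lemma bracketM_add_right (X Y Y' : 𝔪) :
    bracketM X (Y + Y') = bracketM X Y + bracketM X Y' := by
  rw [bracketM, bracketM, bracketM, ← map_add, Submodule.coe_add, Matrix.add_mul, Matrix.mul_add]
  congr 1
  abel

lemma bracketM_smul_left (c : ℝ) (X Y : 𝔪) : bracketM (c • X) Y = c • bracketM X Y := by
  simp only [bracketM, Submodule.coe_smul, Matrix.smul_mul, Matrix.mul_smul,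
    ← smul_sub, map_smul]

lemma bracketM_smul_right (c : ℝ) (X Y : 𝔪) : bracketM X (c • Y) = c • bracketM X Y := by
  simp only [bracketM, Submodule.coe_smul, Matrix.smul_mul, Matrix.mul_smul,
    ← smul_sub, map_smul]

lemma bracketM_Ad (h : H) (X Y : 𝔪) : bracketM (Ad h X) (Ad h Y) = Ad h (bracketM X Y) := by
  rw [bracketM, bracketM, ← proj_conj]
  congr 1
  have e := coe_transpose_mul (h : SO5)
  have key : ∀ A B : Mat5, ((h : SO5) : Mat5) * A * ((h : SO5) : Mat5)ᵀ *
      (((h : SO5) : Mat5) * B * ((h : SO5) : Mat5)ᵀ) =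
      ((h : SO5) : Mat5) * (A * B) * ((h : SO5) : Mat5)ᵀ := by
    intro A B
    calc _ = ((h : SO5) : Mat5) * A * (((h : SO5) : Mat5)ᵀ * ((h : SO5) : Mat5)) * B *
        ((h : SO5) : Mat5)ᵀ := by simp only [Matrix.mul_assoc]
      _ = _ := by rw [e, Matrix.mul_one]; simp only [Matrix.mul_assoc]
  have e1 := key (X : Mat5) (Y : Mat5)
  have e2 := key (Y : Mat5) (X : Mat5)
  change ((h : SO5) : Mat5) * (X : Mat5) * ((h : SO5) : Mat5)ᵀ *
      (((h : SO5) : Mat5) * (Y : Mat5) * ((h : SO5) : Mat5)ᵀ) -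
    ((h : SO5) : Mat5) * (Y : Mat5) * ((h : SO5) : Mat5)ᵀ *
      (((h : SO5) : Mat5) * (X : Mat5) * ((h : SO5) : Mat5)ᵀ) = _
  rw [e1, e2, Matrix.mul_sub, Matrix.sub_mul]

lemma isSmooth_bracketM {X Y : SO5 → 𝔪} (hX : IsSmooth X) (hY : IsSmooth Y) :
    IsSmooth fun g => bracketM (X g) (Y g) := by
  obtain ⟨X', hX1, hX2⟩ := hX
  obtain ⟨Y', hY1, hY2⟩ := hY
  refine ⟨fun A => bracketM (X' A) (Y' A), ?_, fun g => by simp only [hX2, hY2]⟩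
  have h1 : ContDiff ℝ ∞ fun A => ((X' A : 𝔪) : Mat5) := 𝔪.subtypeL.contDiff.comp hX1
  have h2 : ContDiff ℝ ∞ fun A => ((Y' A : 𝔪) : Mat5) := 𝔪.subtypeL.contDiff.comp hY1
  exact (LinearMap.toContinuousLinearMap proj).contDiff.comp ((h1.mul h2).sub (h2.mul h1))

/-- The torsion tensor of the canonical connection, `T(X, Y) = -[X, Y]_𝔪`. -/
def canonicalTorsion (X Y : VectorField) : VectorField :=
  -⟨fun g => bracketM (X.1 g) (Y.1 g), isSmooth_bracketM X.2.1 Y.2.1, fun g h => by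
    simp only [X.2.2, Y.2.2, bracketM_Ad]⟩

/-- The derivative of a function on `M` along `g exp(t Z)` vanishes for `Z` in `g_e`, expressed
through a smooth extension `F'` of its pullback to `SO(5)`. -/
lemma fderiv_vertical (f : SmoothFun) {F' : Mat5 → ℝ} (hF' : ContDiff ℝ ∞ F')
    (hF : ∀ g : SO5, f.1 (QuotientGroup.mk g) = F' (g : Mat5)) (g : SO5) (Z : Mat5)
    (hZ : Zᵀ = -Z) (hZ' : ∀ i j, blk i ≠ blk j → Z i j = 0) :
    fderiv ℝ F' (g : Mat5) ((g : Mat5) * Z) = 0 := by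
  let rot : ℝ → Matrix (Fin 2) (Fin 2) ℝ :=
    fun s => !![Real.cos s, Real.sin s; -Real.sin s, Real.cos s]
  have hrot : ∀ s, rot s ∈ Matrix.specialOrthogonalGroup (Fin 2) ℝ := by
    intro s
    refine Matrix.mem_specialOrthogonalGroup_iff.2
      ⟨(Matrix.mem_orthogonalGroup_iff _ _).2 ?_, ?_⟩
    · ext i j
      have := Real.cos_sq_add_sin_sq s
      fin_cases i <;> fin_cases j <;> simp [rot, Matrix.mul_apply, Fin.sum_univ_succ] <;>
        nlinarith
    · have := Real.cos_sq_add_sin_sq s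
      simp [rot, Matrix.det_fin_two]
      nlinarith
  have hmem : ∀ s r, ∃ h : H, ((h : SO5) : Mat5) = blockDiag (rot s) (rot r) 1 := by
    intro s r
    have horth : blockDiag (rot s) (rot r) 1 * (blockDiag (rot s) (rot r) 1)ᵀ = 1 := by
      rw [blockDiag_transpose, blockDiag_mul, ← blockDiag_one]
      congr 1
      · exact (Matrix.mem_orthogonalGroup_iff _ _).1
          (Matrix.mem_specialOrthogonalGroup_iff.1 (hrot s)).1
      · exact (Matrix.mem_orthogonalGroup_iff _ _).1
          (Matrix.mem_specialOrthogonalGroup_iff.1 (hrot r)).1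
      · simp
    have hdet : (blockDiag (rot s) (rot r) 1).det = 1 := by
      have h1 := Real.cos_sq_add_sin_sq s
      have h2 := Real.cos_sq_add_sin_sq r
      simp [blockDiag, rot, Matrix.det_succ_row_zero, Fin.sum_univ_succ, Fin.succAbove]
      linear_combination (Real.cos r ^ 2 + Real.sin r ^ 2) * h1 + h2
    exact ⟨⟨⟨_, Matrix.mem_specialOrthogonalGroup_iff.2
      ⟨(Matrix.mem_orthogonalGroup_iff _ _).2 horth, hdet⟩⟩,
      ⟨_, hrot s⟩, ⟨_, hrot r⟩, 1, rfl⟩, rfl⟩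
  let c : ℝ → Mat5 := fun t => blockDiag (rot (t * Z 0 1)) (rot (t * Z 2 3)) 1
  have hc : HasDerivAt c Z 0 := by
    have hz : ∀ i j, Z j i = -Z i j := fun i j => congrFun (congrFun hZ i) j
    have hlin : ∀ a : ℝ, HasDerivAt (fun t : ℝ => t * a) a 0 := fun a => by
      simpa using (hasDerivAt_id (0 : ℝ)).mul_const a
    have hcos : ∀ a : ℝ, HasDerivAt (fun t : ℝ => Real.cos (t * a)) 0 0 := fun a => by
      simpa using (hlin a).cos
    have hsin : ∀ a : ℝ, HasDerivAt (fun t : ℝ => Real.sin (t * a)) a 0 := fun a => by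
      simpa using (hlin a).sin
    have hsin' : ∀ a : ℝ, HasDerivAt (fun t : ℝ => -Real.sin (t * a)) (-a) 0 :=
      fun a => (hsin a).neg
    have hentry : ∀ i j, HasDerivAt (fun t => c t i j) (Z i j) 0 := by
      have d : ∀ i, Z i i = 0 := fun i => by linarith [hz i i]
      intro i j
      by_cases hij : blk i = blk j
      · fin_cases i <;> fin_cases j <;> simp [blk] at hij <;>
          simp [c, blockDiag, rot, d, hz 0 1, hz 2 3, hcos, hsin, hsin', hasDerivAt_const]
      · rw [hZ' i j hij]
        have : (fun t => c t i j) = fun _ => 0 :=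
          funext fun t => blockDiag_offDiag _ _ _ i j hij
        rw [this]
        exact hasDerivAt_const _ _
    exact hasDerivAt_pi.2 fun i => hasDerivAt_pi.2 fun j => hentry i j
  have hc0 : c 0 = 1 := by
    have : rot 0 = 1 := by ext i j; fin_cases i <;> fin_cases j <;> simp [rot]
    simp only [c, zero_mul, this, blockDiag_one]
  have h1 : HasFDerivAt F' (fderiv ℝ F' (g : Mat5)) ((g : Mat5) * c 0) := by
    rw [hc0, mul_one]
    exact (hF'.differentiable (by simp) _).hasFDerivAt
  have h2 := h1.comp_hasDerivAt (0 : ℝ) (hc.const_mul (g : Mat5))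
  have h3 : (F' ∘ fun t => (g : Mat5) * c t) = fun _ => F' (g : Mat5) := by
    funext t
    obtain ⟨h, hh⟩ := hmem (t * Z 0 1) (t * Z 2 3)
    have : F' ((g : Mat5) * c t) = f.1 (QuotientGroup.mk (g * (h : SO5))) := by
      rw [hF]
      change _ = F' ((g : Mat5) * ((h : SO5) : Mat5))
      rw [hh]
    rw [Function.comp_apply, this, QuotientGroup.mk_mul_of_mem g h.2, hF]
  rw [h3] at h2
  exact h2.unique (hasDerivAt_const _ _)

lemma fderiv_along_field {A : Type*} [NormedRing A] [NormedAlgebra ℝ A] {F : A → ℝ} {Y : A → A}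
    (hF : ContDiff ℝ ∞ F) (hY : ContDiff ℝ ∞ Y) (a v : A) :
    fderiv ℝ (fun b => fderiv ℝ F b (b * Y b)) a v =
      fderiv ℝ (fderiv ℝ F) a v (a * Y a) + fderiv ℝ F a (v * Y a + a * fderiv ℝ Y a v) := by
  have h1 : HasFDerivAt (fderiv ℝ F) (fderiv ℝ (fderiv ℝ F) a) a :=
    ((hF.fderiv_right (m := ∞) (by simp)).differentiable (by simp) a).hasFDerivAt
  have h2 : HasFDerivAt Y (fderiv ℝ Y a) a := (hY.differentiable (by simp) a).hasFDerivAt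
  have h3 : HasFDerivAt (fun b => fderiv ℝ F b (b * Y b)) _ a :=
    h1.clm_apply ((hasFDerivAt_id a).mul' h2)
  rw [h3.fderiv]
  simp [add_comm]

lemma fderiv_commutator {A : Type*} [NormedRing A] [NormedAlgebra ℝ A] {F : A → ℝ} {X Y : A → A}
    (hF : ContDiff ℝ ∞ F) (hX : ContDiff ℝ ∞ X) (hY : ContDiff ℝ ∞ Y) (a : A) :
    fderiv ℝ (fun b => fderiv ℝ F b (b * Y b)) a (a * X a) -
        fderiv ℝ (fun b => fderiv ℝ F b (b * X b)) a (a * Y a) =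
      fderiv ℝ F a (a * (X a * Y a - Y a * X a)) +
        fderiv ℝ F a (a * fderiv ℝ Y a (a * X a)) -
        fderiv ℝ F a (a * fderiv ℝ X a (a * Y a)) := by
  rw [fderiv_along_field hF hY, fderiv_along_field hF hX]
  have hs : IsSymmSndFDerivAt ℝ F a := hF.contDiffAt.isSymmSndFDerivAt (by
    simp only [minSmoothness_of_isRCLikeNormedField]
    exact WithTop.coe_le_coe.2 (le_top : (2 : ℕ∞) ≤ ⊤))
  rw [hs.eq (a * X a) (a * Y a), mul_sub, map_sub, map_add, map_add, ← mul_assoc, ← mul_assoc]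
  ring

lemma canonical_isTorsion : canonical.IsTorsion canonicalTorsion := by
  intro X Y f
  obtain ⟨X', hX1, hX2⟩ := X.2.1
  obtain ⟨Y', hY1, hY2⟩ := Y.2.1
  obtain ⟨f', hf1, hf2⟩ := f.2
  have hcX : ContDiff ℝ ∞ fun A => ((X' A : 𝔪) : Mat5) := 𝔪.subtypeL.contDiff.comp hX1
  have hcY : ContDiff ℝ ∞ fun A => ((Y' A : 𝔪) : Mat5) := 𝔪.subtypeL.contDiff.comp hY1
  have hdiff : ∀ W : Mat5 → Mat5, ContDiff ℝ ∞ W →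
      ContDiff ℝ ∞ fun A => fderiv ℝ f' A (A * W A) := fun W hW =>
    ContDiff.fderiv_apply (m := ∞) (n := ∞) (f := fun _ : Mat5 => f')
      (hf1.comp contDiff_snd) contDiff_id (contDiff_id.mul hW) (by simp)
  have hcoe : ∀ (W : Mat5 → 𝔪), ContDiff ℝ ∞ W → ∀ a v : Mat5,
      fderiv ℝ (fun A => ((W A : 𝔪) : Mat5)) a v = ((fderiv ℝ W a v : 𝔪) : Mat5) := by
    intro W hW a v
    have h1 : HasFDerivAt W (fderiv ℝ W a) a := (hW.differentiable (by simp) a).hasFDerivAt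
    have h2 : HasFDerivAt (fun A => ((W A : 𝔪) : Mat5)) (𝔪.subtypeL.comp (fderiv ℝ W a)) a :=
      𝔪.subtypeL.hasFDerivAt.comp a h1
    rw [h2.fderiv]
    rfl
  apply Subtype.ext
  funext q
  induction q using QuotientGroup.induction_on with
  | H g =>
  change horDeriv (canonicalTorsion X Y).1 (fun g : SO5 => f.1 (QuotientGroup.mk g)) g =
    horDeriv (horDeriv X.1 Y.1) (fun g : SO5 => f.1 (QuotientGroup.mk g)) g -
    horDeriv (horDeriv Y.1 X.1) (fun g : SO5 => f.1 (QuotientGroup.mk g)) g -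
    (horDeriv X.1 (horDeriv Y.1 fun g : SO5 => f.1 (QuotientGroup.mk g)) g -
      horDeriv Y.1 (horDeriv X.1 fun g : SO5 => f.1 (QuotientGroup.mk g)) g)
  rw [horDeriv_eq hf1 hf2, horDeriv_eq hf1 hf2, horDeriv_eq hf1 hf2,
    horDeriv_eq (hdiff _ hcY) (F := horDeriv Y.1 _)
      (fun a => by rw [horDeriv_eq hf1 hf2, hY2]),
    horDeriv_eq (hdiff _ hcX) (F := horDeriv X.1 _)
      (fun a => by rw [horDeriv_eq hf1 hf2, hX2]),
    horDeriv_eq hY1 hY2, horDeriv_eq hX1 hX2, hX2, hY2]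
  have hcomm : fderiv ℝ (fun A : Mat5 => fderiv ℝ f' A (A * (Y' A : Mat5))) g (g * (X' g : Mat5)) -
        fderiv ℝ (fun A : Mat5 => fderiv ℝ f' A (A * (X' A : Mat5))) g (g * (Y' g : Mat5)) =
      fderiv ℝ f' g (g * ((X' g : Mat5) * (Y' g : Mat5) - (Y' g : Mat5) * (X' g : Mat5))) +
        fderiv ℝ f' g (g * fderiv ℝ (fun A => ((Y' A : 𝔪) : Mat5)) g (g * (X' g : Mat5))) -
        fderiv ℝ f' g (g * fderiv ℝ (fun A => ((X' A : 𝔪) : Mat5)) g (g * (Y' g : Mat5))) :=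
    fderiv_commutator hf1 hcX hcY (g : Mat5)
  rw [hcoe _ hX1, hcoe _ hY1] at hcomm
  rw [hcomm]
  have hT : ((canonicalTorsion X Y).1 g : Mat5) =
      -(bracketM (X' (g : Mat5)) (Y' (g : Mat5)) : Mat5) := by
    rw [← hX2, ← hY2]
    rfl
  rw [hT]
  have hv := fderiv_vertical f hf1 hf2 g
    ((X' (g : Mat5) : Mat5) * (Y' (g : Mat5) : Mat5) -
      (Y' (g : Mat5) : Mat5) * (X' (g : Mat5) : Mat5) -
      (bracketM (X' (g : Mat5)) (Y' (g : Mat5)) : Mat5))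
  have hskew : ((X' (g : Mat5) : Mat5) * (Y' (g : Mat5) : Mat5) -
      (Y' (g : Mat5) : Mat5) * (X' (g : Mat5) : Mat5))ᵀ =
      -((X' (g : Mat5) : Mat5) * (Y' (g : Mat5) : Mat5) -
      (Y' (g : Mat5) : Mat5) * (X' (g : Mat5) : Mat5)) := by
    rw [Matrix.transpose_sub, Matrix.transpose_mul, Matrix.transpose_mul, (X' _).2.1, (Y' _).2.1]
    simp
  have hv' := hv (by
      rw [Matrix.transpose_sub, hskew, (bracketM _ _).2.1]
      abel) (by
      intro i j hij
      have hs := congrFun (congrFun hskew i) j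
      simp only [Matrix.transpose_apply, Matrix.neg_apply] at hs
      rw [Matrix.sub_apply]
      simp only [bracketM, proj, LinearMap.coe_mk, AddHom.coe_mk, Matrix.of_apply, if_neg hij, hs]
      ring)
  rw [mul_sub, map_sub, sub_eq_zero] at hv'
  rw [hv', mul_neg, map_neg]
  have alg : ∀ a p q : ℝ, -a = p - q - (a + p - q) := by intros; ring
  exact alg _ _ _

/-- The torsion-free canonical connection `∇ - T / 2`, where `T` is the torsion of the canonical
connection `∇`. -/
def canonicalTorsionFree : AffineConnection where
  cov X Y := canonical.cov X Y - (1 / 2 : ℝ) • canonicalTorsion X Y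
  add_left X X' Y := by
    rw [canonical.add_left]
    have : canonicalTorsion (X + X') Y = canonicalTorsion X Y + canonicalTorsion X' Y := by
      apply Subtype.ext
      funext g
      simp [canonicalTorsion, bracketM_add_left]
      abel
    rw [this, smul_add]
    abel
  smul_left f X Y := by
    rw [canonical.smul_left]
    apply Subtype.ext
    funext g
    simp [canonicalTorsion, bracketM_smul_left, fmul]
    module
  add_right X Y Y' := by
    rw [canonical.add_right]
    have : canonicalTorsion X (Y + Y') = canonicalTorsion X Y + canonicalTorsion X Y' := by
      apply Subtype.ext
      funext g
      simp [canonicalTorsion, bracketM_add_right]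
      abel
    rw [this, smul_add]
    abel
  leibniz X f Y := by
    rw [canonical.leibniz]
    apply Subtype.ext
    funext g
    simp [canonicalTorsion, bracketM_smul_right, fmul]
    module

/-! ## Invariant metrics and their Levi-Civita connection -/

/-- An `SO(5)`-invariant pseudo-Riemannian metric on `M = SO(5)/H`, given by the corresponding
`Ad(H)`-invariant nondegenerate symmetric bilinear form `B` on `𝔪`, the tangent space at the
origin. -/
structure InvariantMetric where
  /-- The bilinear form `B` on `𝔪`. -/
  B : LinearMap.BilinForm ℝ 𝔪
  symm : ∀ X Y, B X Y = B Y X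
  nondegenerate : ∀ X, (∀ Y, B X Y = 0) → X = 0
  invariant : ∀ (h : H) (X Y : 𝔪), B (Ad h X) (Ad h Y) = B X Y

/-- The metric is Riemannian. -/
def InvariantMetric.IsRiemannian (g : InvariantMetric) : Prop := ∀ X, X ≠ 0 → 0 < g.B X X

/-- The homogeneous components `g_a, g_b, g_c` of `𝔪` are pairwise orthogonal. -/
def InvariantMetric.OrthogonalComponents (g : InvariantMetric) : Prop :=
  ∀ X Y, (InGa X ∧ InGb Y) ∨ (InGa X ∧ InGc Y) ∨ (InGb X ∧ InGc Y) → g.B X Y = 0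

/-- `B([Z, X]_𝔪, Y) + B(X, [Z, Y]_𝔪) = 0` on `𝔪`: natural reductivity with respect to
`so(5) = g_e ⊕ 𝔪`. -/
def InvariantMetric.IsNaturallyReductive (g : InvariantMetric) : Prop :=
  ∀ X Y Z, g.B X (bracketM Z Y) + g.B (bracketM Z X) Y = 0

/-- The smooth function `g(X, Y)` on `M`: left translation by `a` is an isometry, so the value at
`aH` is `B (X(a), Y(a))`. -/
def InvariantMetric.inner (g : InvariantMetric) (X Y : VectorField) : SmoothFun :=
  ⟨Quotient.lift (fun a : SO5 => g.B (X.1 a) (Y.1 a)) (by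
    intro a b hab
    obtain ⟨h, rfl⟩ : ∃ h : H, b = a * (h : SO5) :=
      ⟨⟨a⁻¹ * b, QuotientGroup.leftRel_apply.1 hab⟩, by simp⟩
    rw [X.2.2, Y.2.2, g.invariant]), by
    obtain ⟨X', hX1, hX2⟩ := X.2.1
    obtain ⟨Y', hY1, hY2⟩ := Y.2.1
    refine ⟨fun A => g.B (X' A) (Y' A), ?_, fun a => ?_⟩
    · exact ((LinearMap.toContinuousLinearMap
        (LinearMap.toContinuousLinearMap.toLinearMap ∘ₗ g.B)).contDiff.comp hX1).clm_apply hY1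
    · change g.B (X.1 a) (Y.1 a) = _
      rw [hX2, hY2]⟩

/-- `D` is a Levi-Civita connection of `g`: it is torsion-free and metric. -/
def InvariantMetric.IsLeviCivita (g : InvariantMetric) (D : AffineConnection) : Prop :=
  D.IsTorsion (fun _ _ => 0) ∧
    ∀ X Y Z, act X (g.inner Y Z) = g.inner (D.cov X Y) Z + g.inner Y (D.cov X Z)

/-! ## Coordinates on `𝔪` -/

/-- The coordinate form `α_i`, for the entries `a₁, a₂, a₃, a₄`. -/
def α (i : Fin 4) (X : 𝔪) : ℝ :=
  ![(X : Mat5) 0 2, (X : Mat5) 0 3, (X : Mat5) 1 2, (X : Mat5) 1 3] i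

/-- The coordinate form `β_i`, for the entries `b₁, b₂`. -/
def β (i : Fin 2) (X : 𝔪) : ℝ := ![(X : Mat5) 0 4, (X : Mat5) 1 4] i

/-- The coordinate form `γ_i`, for the entries `c₁, c₂`. -/
def γ (i : Fin 2) (X : 𝔪) : ℝ := ![(X : Mat5) 2 4, (X : Mat5) 3 4] i

/-- The quadratic form `∑ α_i² + ∑ β_i² + ∑ γ_i²` on `𝔪`. -/
def sumSq (X : 𝔪) : ℝ := ∑ i, α i X ^ 2 + ∑ i, β i X ^ 2 + ∑ i, γ i X ^ 2

end

end FlagSO5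

open scoped Matrix ContDiff

namespace FlagSO5

noncomputable section

attribute [local instance] Matrix.linftyOpNormedRing Matrix.linftyOpNormedAlgebra
  Matrix.linftyOpNormedAddCommGroup Matrix.linftyOpNormedSpace

/-! ## Coordinates on `𝔪` and the invariant bilinear forms -/

/-! The canonical connection `∇` already makes every invariant metric parallel
(`InvariantMetric.act_inner`), because `B` is constant on `SO(5) ×_H 𝔪`. Its only defect is its
torsion `-[X, Y]_𝔪`. The Levi-Civita connection is therefore sought as `∇ + A`, with `A` an
`Ad(H)`-equivariant bilinear map on `𝔪`. It is torsion-free when `A(X, Y) - A(Y, X) = [X, Y]_𝔪` and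
metric when every `A(X, ·)` is `B`-skew. The algebraic Koszul formula
(`InvariantMetric.exists_koszul`) provides such an `A`; uniqueness is the usual fact that a
trilinear expression symmetric in two slots and skew in two others vanishes.

In Koszul's formula `2 B(A(X, Y), Z)` equals `B([X, Y]_𝔪, Z)` plus the expression whose vanishing is
natural reductivity. Since `∇ - T/2` is the choice `A = ½[·,·]_𝔪`, the two connections agree exactly
when `g` is naturally reductive (`InvariantMetric.exists_leviCivita`).

The rest is linear algebra. Two elements of `H` already reduce `B` to four parameters `t, u, v, w`
(`InvariantMetric.exists_coeff`), and the explicit bracket turns natural reductivity into `u = 0`,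
`t = v = w` (`InvariantMetric.isNaturallyReductive_iff`).

Torsion is defined by the action on functions, so it must also be known that vector fields are
determined by this action (`act_injective`) and that global fields take every tangent value
(`exists_vectorField_eq`). -/

/-- The element of `𝔪` with the given coordinates. -/
def mkM (a₁ a₂ a₃ a₄ b₁ b₂ c₁ c₂ : ℝ) : 𝔪 :=
  ⟨!![0, 0, a₁, a₂, b₁;
      0, 0, a₃, a₄, b₂;
      -a₁, -a₃, 0, 0, c₁;
      -a₂, -a₄, 0, 0, c₂;
      -b₁, -b₂, -c₁, -c₂, 0], by
    refine ⟨?_, fun i j hij => ?_⟩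
    · ext i j
      fin_cases i <;> fin_cases j <;> simp
    · fin_cases i <;> fin_cases j <;> simp_all [blk]⟩

lemma ext_of_lt {X Y : 𝔪} (h : ∀ i j, i < j → blk i ≠ blk j → (X : Mat5) i j = (Y : Mat5) i j) :
    X = Y := by
  ext i j
  by_cases hij : blk i = blk j
  · rw [X.2.2 i j hij, Y.2.2 i j hij]
  · rcases lt_trichotomy i j with hlt | heq | hgt
    · exact h i j hlt hij
    · exact absurd (congrArg blk heq) hij
    · have hX : (X : Mat5) i j = -(X : Mat5) j i := congrFun (congrFun X.2.1 j) i
      have hY : (Y : Mat5) i j = -(Y : Mat5) j i := congrFun (congrFun Y.2.1 j) i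
      rw [hX, hY, h j i hgt (Ne.symm hij)]

lemma eq_mkM (X : 𝔪) :
    X = mkM (α 0 X) (α 1 X) (α 2 X) (α 3 X) (β 0 X) (β 1 X) (γ 0 X) (γ 1 X) := by
  refine ext_of_lt fun i j hij hb => ?_
  fin_cases i <;> fin_cases j <;> simp [blk] at hij hb <;> simp [mkM, α, β, γ]

lemma mkM_add (a₁ a₂ a₃ a₄ b₁ b₂ c₁ c₂ a₁' a₂' a₃' a₄' b₁' b₂' c₁' c₂' : ℝ) :
    mkM a₁ a₂ a₃ a₄ b₁ b₂ c₁ c₂ + mkM a₁' a₂' a₃' a₄' b₁' b₂' c₁' c₂' =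
      mkM (a₁ + a₁') (a₂ + a₂') (a₃ + a₃') (a₄ + a₄') (b₁ + b₁') (b₂ + b₂') (c₁ + c₁')
        (c₂ + c₂') := by
  refine ext_of_lt fun i j hij hb => ?_
  fin_cases i <;> fin_cases j <;> simp [blk] at hij hb <;> simp [mkM]

lemma smul_mkM (r a₁ a₂ a₃ a₄ b₁ b₂ c₁ c₂ : ℝ) :
    r • mkM a₁ a₂ a₃ a₄ b₁ b₂ c₁ c₂ =
      mkM (r * a₁) (r * a₂) (r * a₃) (r * a₄) (r * b₁) (r * b₂) (r * c₁) (r * c₂) := by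
  refine ext_of_lt fun i j hij hb => ?_
  fin_cases i <;> fin_cases j <;> simp [blk] at hij hb <;> simp [mkM]

/-- The formula displays the grading: two different components bracket into the third, while a
component bracketed with itself lands in `g_e` and contributes nothing. -/
lemma bracketM_mkM (a₁ a₂ a₃ a₄ b₁ b₂ c₁ c₂ a₁' a₂' a₃' a₄' b₁' b₂' c₁' c₂' : ℝ) :
    bracketM (mkM a₁ a₂ a₃ a₄ b₁ b₂ c₁ c₂) (mkM a₁' a₂' a₃' a₄' b₁' b₂' c₁' c₂') =
      mkM (b₁' * c₁ - b₁ * c₁') (b₁' * c₂ - b₁ * c₂') (b₂' * c₁ - b₂ * c₁') (b₂' * c₂ - b₂ * c₂')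
        (a₁ * c₁' + a₂ * c₂' - a₁' * c₁ - a₂' * c₂) (a₃ * c₁' + a₄ * c₂' - a₃' * c₁ - a₄' * c₂)
        (a₁' * b₁ + a₃' * b₂ - a₁ * b₁' - a₃ * b₂')
        (a₂' * b₁ + a₄' * b₂ - a₂ * b₁' - a₄ * b₂') := by
  refine ext_of_lt fun i j hij hb => ?_
  fin_cases i <;> fin_cases j <;> simp [blk] at hij hb <;>
    simp [mkM, bracketM, proj, blk] <;> ring

lemma inGa_mkM (a₁ a₂ a₃ a₄ : ℝ) : InGa (mkM a₁ a₂ a₃ a₄ 0 0 0 0) := by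
  intro i j h hij
  fin_cases i <;> fin_cases j <;> simp_all [mkM, Fin.lt_def]

lemma inGb_mkM (b₁ b₂ : ℝ) : InGb (mkM 0 0 0 0 b₁ b₂ 0 0) := by
  intro i j h hij
  fin_cases i <;> fin_cases j <;> simp_all [mkM, Fin.lt_def]

lemma inGc_mkM (c₁ c₂ : ℝ) : InGc (mkM 0 0 0 0 0 0 c₁ c₂) := by
  intro i j h hij
  fin_cases i <;> fin_cases j <;> simp_all [mkM, Fin.lt_def]

/-! ### Quarter turns in `H` and the forms they leave invariant -/

lemma coe_Ad (h : H) (X : 𝔪) :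
    (Ad h X : Mat5) = ((h : SO5) : Mat5) * (X : Mat5) * ((h : SO5) : Mat5)ᵀ := rfl

/-- The rotation by a right angle in the plane. -/
def rightAngle : Matrix.specialOrthogonalGroup (Fin 2) ℝ :=
  ⟨!![0, 1; -1, 0], Matrix.mem_specialOrthogonalGroup_iff.2
    ⟨(Matrix.mem_orthogonalGroup_iff _ _).2 (by
      ext i j
      fin_cases i <;> fin_cases j <;> simp [Matrix.mul_apply, Fin.sum_univ_succ]),
    by simp [Matrix.det_fin_two]⟩⟩

/-- The quarter turn in the first `SO(2)` factor. Together with the one in the second factor it is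
all of `H` that the classification of invariant forms needs. -/
lemma exists_Ad_first : ∃ h : H, ∀ a₁ a₂ a₃ a₄ b₁ b₂ c₁ c₂ : ℝ,
    Ad h (mkM a₁ a₂ a₃ a₄ b₁ b₂ c₁ c₂) = mkM a₃ a₄ (-a₁) (-a₂) b₂ (-b₁) c₁ c₂ := by
  have hdet : (blockDiag (rightAngle : Matrix _ _ ℝ) 1 1).det = 1 := by
    simp [blockDiag, rightAngle, Matrix.det_succ_row_zero, Fin.sum_univ_succ, Fin.succAbove]
  have horth : blockDiag (rightAngle : Matrix _ _ ℝ) 1 1 *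
      (blockDiag (rightAngle : Matrix _ _ ℝ) 1 1)ᵀ = 1 := by
    ext i j
    fin_cases i <;> fin_cases j <;>
      simp [blockDiag, rightAngle, Matrix.mul_apply, Fin.sum_univ_succ]
  refine ⟨⟨⟨_, Matrix.mem_specialOrthogonalGroup_iff.2
    ⟨(Matrix.mem_orthogonalGroup_iff _ _).2 horth, hdet⟩⟩, rightAngle, 1, 1, rfl⟩, ?_⟩
  intros
  refine ext_of_lt fun i j hij hb => ?_
  rw [coe_Ad]
  fin_cases i <;> fin_cases j <;> simp [blk] at hij hb <;>
    simp [mkM, blockDiag, rightAngle, Matrix.mul_apply, Fin.sum_univ_succ]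

lemma exists_Ad_second : ∃ h : H, ∀ a₁ a₂ a₃ a₄ b₁ b₂ c₁ c₂ : ℝ,
    Ad h (mkM a₁ a₂ a₃ a₄ b₁ b₂ c₁ c₂) = mkM a₂ (-a₁) a₄ (-a₃) b₁ b₂ c₂ (-c₁) := by
  have hdet : (blockDiag 1 (rightAngle : Matrix _ _ ℝ) 1).det = 1 := by
    simp [blockDiag, rightAngle, Matrix.det_succ_row_zero, Fin.sum_univ_succ, Fin.succAbove]
  have horth : blockDiag 1 (rightAngle : Matrix _ _ ℝ) 1 *
      (blockDiag 1 (rightAngle : Matrix _ _ ℝ) 1)ᵀ = 1 := by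
    ext i j
    fin_cases i <;> fin_cases j <;>
      simp [blockDiag, rightAngle, Matrix.mul_apply, Fin.sum_univ_succ]
  refine ⟨⟨⟨_, Matrix.mem_specialOrthogonalGroup_iff.2
    ⟨(Matrix.mem_orthogonalGroup_iff _ _).2 horth, hdet⟩⟩, 1, rightAngle, 1, rfl⟩, ?_⟩
  intros
  refine ext_of_lt fun i j hij hb => ?_
  rw [coe_Ad]
  fin_cases i <;> fin_cases j <;> simp [blk] at hij hb <;>
    simp [mkM, blockDiag, rightAngle, Matrix.mul_apply, Fin.sum_univ_succ]

lemma neg_mkM (a₁ a₂ a₃ a₄ b₁ b₂ c₁ c₂ : ℝ) :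
    -mkM a₁ a₂ a₃ a₄ b₁ b₂ c₁ c₂ = mkM (-a₁) (-a₂) (-a₃) (-a₄) (-b₁) (-b₂) (-c₁) (-c₂) := by
  rw [← neg_one_smul ℝ, smul_mkM]
  simp only [neg_one_mul]

/-- The invariant forms for which the homogeneous components are orthogonal, in coordinates. -/
lemma InvariantMetric.exists_coeff (g : InvariantMetric) (horth : g.OrthogonalComponents) :
    ∃ t u v w : ℝ, ∀ a₁ a₂ a₃ a₄ b₁ b₂ c₁ c₂ a₁' a₂' a₃' a₄' b₁' b₂' c₁' c₂' : ℝ,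
      g.B (mkM a₁ a₂ a₃ a₄ b₁ b₂ c₁ c₂) (mkM a₁' a₂' a₃' a₄' b₁' b₂' c₁' c₂') =
        t * (a₁ * a₁' + a₂ * a₂' + a₃ * a₃' + a₄ * a₄') +
        u / 2 * (a₁ * a₄' + a₄ * a₁' - a₂ * a₃' - a₃ * a₂') +
        v * (b₁ * b₁' + b₂ * b₂') + w * (c₁ * c₁' + c₂ * c₂') := by
  obtain ⟨h₁, H₁⟩ := exists_Ad_first
  obtain ⟨h₂, H₂⟩ := exists_Ad_second
  have I₁ := g.invariant h₁
  have I₂ := g.invariant h₂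
  set A₁ := mkM 1 0 0 0 0 0 0 0 with hA₁
  set A₂ := mkM 0 1 0 0 0 0 0 0 with hA₂
  set A₃ := mkM 0 0 1 0 0 0 0 0 with hA₃
  set A₄ := mkM 0 0 0 1 0 0 0 0 with hA₄
  set B₁ := mkM 0 0 0 0 1 0 0 0 with hB₁
  set B₂ := mkM 0 0 0 0 0 1 0 0 with hB₂
  set C₁ := mkM 0 0 0 0 0 0 1 0 with hC₁
  set C₂ := mkM 0 0 0 0 0 0 0 1 with hC₂
  -- Both quarter turns act on the coordinate basis as signed permutations, so invariance becomes
  -- linear relations between the entries of the Gram matrix.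
  have p1 : Ad h₁ A₁ = -A₃ := by simp only [hA₁, hA₃, H₁, neg_mkM, neg_zero]
  have p2 : Ad h₁ A₂ = -A₄ := by simp only [hA₂, hA₄, H₁, neg_mkM, neg_zero]
  have p3 : Ad h₁ A₃ = A₁ := by simp only [hA₁, hA₃, H₁, neg_zero]
  have p4 : Ad h₁ A₄ = A₂ := by simp only [hA₂, hA₄, H₁, neg_zero]
  have p5 : Ad h₁ B₁ = -B₂ := by simp only [hB₁, hB₂, H₁, neg_mkM, neg_zero]
  have p6 : Ad h₁ B₂ = B₁ := by simp only [hB₁, hB₂, H₁, neg_zero]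
  have q1 : Ad h₂ A₁ = -A₂ := by simp only [hA₁, hA₂, H₂, neg_mkM, neg_zero]
  have q2 : Ad h₂ A₂ = A₁ := by simp only [hA₁, hA₂, H₂, neg_zero]
  have q3 : Ad h₂ A₃ = -A₄ := by simp only [hA₃, hA₄, H₂, neg_mkM, neg_zero]
  have q4 : Ad h₂ A₄ = A₃ := by simp only [hA₃, hA₄, H₂, neg_zero]
  have q5 : Ad h₂ C₁ = -C₂ := by simp only [hC₁, hC₂, H₂, neg_mkM, neg_zero]
  have q6 : Ad h₂ C₂ = C₁ := by simp only [hC₁, hC₂, H₂, neg_zero]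
  have s := g.symm
  have t₁ : g.B A₁ A₁ = g.B A₃ A₃ := by simpa [p3] using I₁ A₃ A₃
  have t₂ : g.B A₂ A₂ = g.B A₄ A₄ := by simpa [p4] using I₁ A₄ A₄
  have t₃ : g.B A₁ A₁ = g.B A₂ A₂ := by simpa [q2] using I₂ A₂ A₂
  -- A turn sending `A₁` to `-A₂` and `A₂` to `A₁` reverses the sign of their product, which
  -- therefore vanishes. The other orthogonality relations inside a component arise in the same way.
  have z₁₂ : g.B A₁ A₂ = 0 := by
    have := I₂ A₁ A₂
    simp only [q1, q2, map_neg, LinearMap.neg_apply, s A₂ A₁] at this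
    linarith
  have z₃₄ : g.B A₃ A₄ = 0 := by
    have := I₂ A₃ A₄
    simp only [q3, q4, map_neg, LinearMap.neg_apply, s A₄ A₃] at this
    linarith
  have z₁₃ : g.B A₁ A₃ = 0 := by
    have := I₁ A₁ A₃
    simp only [p1, p3, map_neg, LinearMap.neg_apply, s A₃ A₁] at this
    linarith
  have z₂₄ : g.B A₂ A₄ = 0 := by
    have := I₁ A₂ A₄
    simp only [p2, p4, map_neg, LinearMap.neg_apply, s A₄ A₂] at this
    linarith
  -- The product of `A₁` and `A₄` is only tied to that of `A₂` and `A₃`, not killed. This leaves the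
  -- parameter `u`.
  have z₂₃ : g.B A₂ A₃ = -g.B A₁ A₄ := by
    have := I₁ A₁ A₄
    simp only [p1, p4, map_neg, LinearMap.neg_apply, s A₃ A₂] at this
    linarith
  have v₁ : g.B B₁ B₁ = g.B B₂ B₂ := by simpa [p6] using I₁ B₂ B₂
  have v₂ : g.B B₁ B₂ = 0 := by
    have := I₁ B₁ B₂
    simp only [p5, p6, map_neg, LinearMap.neg_apply, s B₂ B₁] at this
    linarith
  have w₁ : g.B C₁ C₁ = g.B C₂ C₂ := by simpa [q6] using I₂ C₂ C₂
  have w₂ : g.B C₁ C₂ = 0 := by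
    have := I₂ C₁ C₂
    simp only [q5, q6, map_neg, LinearMap.neg_apply, s C₂ C₁] at this
    linarith
  -- The factor 2 makes `u` the coefficient of `α₁α₄` in the quadratic form, where the off-diagonal
  -- Gram entry is counted twice.
  refine ⟨g.B A₁ A₁, 2 * g.B A₁ A₄, g.B B₁ B₁, g.B C₁ C₁, ?_⟩
  intro a₁ a₂ a₃ a₄ b₁ b₂ c₁ c₂ a₁' a₂' a₃' a₄' b₁' b₂' c₁' c₂'
  have split : ∀ a₁ a₂ a₃ a₄ b₁ b₂ c₁ c₂ : ℝ, mkM a₁ a₂ a₃ a₄ b₁ b₂ c₁ c₂ =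
      mkM a₁ a₂ a₃ a₄ 0 0 0 0 + mkM 0 0 0 0 b₁ b₂ 0 0 + mkM 0 0 0 0 0 0 c₁ c₂ := by
    intros
    simp only [mkM_add, add_zero, zero_add]
  have ab : ∀ a₁ a₂ a₃ a₄ b₁ b₂ : ℝ,
      g.B (mkM a₁ a₂ a₃ a₄ 0 0 0 0) (mkM 0 0 0 0 b₁ b₂ 0 0) = 0 := fun _ _ _ _ _ _ =>
    horth _ _ (Or.inl ⟨inGa_mkM _ _ _ _, inGb_mkM _ _⟩)
  have ac : ∀ a₁ a₂ a₃ a₄ c₁ c₂ : ℝ,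
      g.B (mkM a₁ a₂ a₃ a₄ 0 0 0 0) (mkM 0 0 0 0 0 0 c₁ c₂) = 0 := fun _ _ _ _ _ _ =>
    horth _ _ (Or.inr (Or.inl ⟨inGa_mkM _ _ _ _, inGc_mkM _ _⟩))
  have bc : ∀ b₁ b₂ c₁ c₂ : ℝ,
      g.B (mkM 0 0 0 0 b₁ b₂ 0 0) (mkM 0 0 0 0 0 0 c₁ c₂) = 0 := fun _ _ _ _ =>
    horth _ _ (Or.inr (Or.inr ⟨inGb_mkM _ _, inGc_mkM _ _⟩))
  have ba : ∀ a₁ a₂ a₃ a₄ b₁ b₂ : ℝ,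
      g.B (mkM 0 0 0 0 b₁ b₂ 0 0) (mkM a₁ a₂ a₃ a₄ 0 0 0 0) = 0 := fun _ _ _ _ _ _ => by
    rw [s, ab]
  have ca : ∀ a₁ a₂ a₃ a₄ c₁ c₂ : ℝ,
      g.B (mkM 0 0 0 0 0 0 c₁ c₂) (mkM a₁ a₂ a₃ a₄ 0 0 0 0) = 0 := fun _ _ _ _ _ _ => by
    rw [s, ac]
  have cb : ∀ b₁ b₂ c₁ c₂ : ℝ,
      g.B (mkM 0 0 0 0 0 0 c₁ c₂) (mkM 0 0 0 0 b₁ b₂ 0 0) = 0 := fun _ _ _ _ => by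
    rw [s, bc]
  have ea : ∀ a₁ a₂ a₃ a₄ : ℝ, mkM a₁ a₂ a₃ a₄ 0 0 0 0 =
      a₁ • A₁ + a₂ • A₂ + a₃ • A₃ + a₄ • A₄ := by
    intros
    simp only [hA₁, hA₂, hA₃, hA₄, smul_mkM, mkM_add, mul_one, mul_zero, add_zero, zero_add]
  have eb : ∀ b₁ b₂ : ℝ, mkM 0 0 0 0 b₁ b₂ 0 0 = b₁ • B₁ + b₂ • B₂ := by
    intros
    simp only [hB₁, hB₂, smul_mkM, mkM_add, mul_one, mul_zero, add_zero, zero_add]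
  have ec : ∀ c₁ c₂ : ℝ, mkM 0 0 0 0 0 0 c₁ c₂ = c₁ • C₁ + c₂ • C₂ := by
    intros
    simp only [hC₁, hC₂, smul_mkM, mkM_add, mul_one, mul_zero, add_zero, zero_add]
  rw [split a₁, split a₁']
  simp only [map_add, LinearMap.add_apply, ab, ac, bc, ba, ca, cb, add_zero, zero_add]
  simp only [ea, eb, ec, map_add, LinearMap.add_apply, map_smul, LinearMap.smul_apply,
    smul_eq_mul, s A₂ A₁, s A₃ A₁, s A₃ A₂, s A₄ A₁, s A₄ A₂, s A₄ A₃, s B₂ B₁, s C₂ C₁,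
    z₁₂, z₁₃, z₂₃, z₂₄, z₃₄, v₂, w₂, ← v₁, ← w₁, ← t₂, ← t₃, ← t₁]
  ring

/-- Three triples of basis vectors suffice for necessity. Conversely, equal coefficients and `u = 0`
make `B` a multiple of the standard form, for which the identity is polynomial in the coordinates.
-/
lemma InvariantMetric.isNaturallyReductive_iff (g : InvariantMetric) {t u v w : ℝ}
    (hB : ∀ a₁ a₂ a₃ a₄ b₁ b₂ c₁ c₂ a₁' a₂' a₃' a₄' b₁' b₂' c₁' c₂' : ℝ,
      g.B (mkM a₁ a₂ a₃ a₄ b₁ b₂ c₁ c₂) (mkM a₁' a₂' a₃' a₄' b₁' b₂' c₁' c₂') =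
        t * (a₁ * a₁' + a₂ * a₂' + a₃ * a₃' + a₄ * a₄') +
        u / 2 * (a₁ * a₄' + a₄ * a₁' - a₂ * a₃' - a₃ * a₂') +
        v * (b₁ * b₁' + b₂ * b₂') + w * (c₁ * c₁' + c₂ * c₂')) :
    g.IsNaturallyReductive ↔ u = 0 ∧ t = v ∧ v = w := by
  constructor
  · intro h
    -- For the first triple `[C₂, B₂]_𝔪 = A₄` and `[C₂, A₁]_𝔪 = 0`, so only `B(A₁, A₄) = u/2`
    -- remains. The other two triples run through `A₁, B₁, C₁` and give `t - v = 0` and `v - w = 0`.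
    have h₁ := h (mkM 1 0 0 0 0 0 0 0) (mkM 0 0 0 0 0 1 0 0) (mkM 0 0 0 0 0 0 0 1)
    have h₂ := h (mkM 1 0 0 0 0 0 0 0) (mkM 0 0 0 0 1 0 0 0) (mkM 0 0 0 0 0 0 1 0)
    have h₃ := h (mkM 0 0 0 0 1 0 0 0) (mkM 0 0 0 0 0 0 1 0) (mkM 1 0 0 0 0 0 0 0)
    rw [bracketM_mkM, bracketM_mkM, hB, hB] at h₁ h₂ h₃
    norm_num at h₁ h₂ h₃
    exact ⟨h₁, by linarith, by linarith⟩
  · rintro ⟨rfl, rfl, rfl⟩ X Y Z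
    rw [eq_mkM X, eq_mkM Y, eq_mkM Z, bracketM_mkM, bracketM_mkM, hB, hB]
    ring

/-! ## Calculus of bilinear maps -/

section Bilinear

variable {E F G P : Type*} [NormedAddCommGroup E] [NormedSpace ℝ E] [FiniteDimensional ℝ E]
  [NormedAddCommGroup F] [NormedSpace ℝ F] [FiniteDimensional ℝ F]
  [NormedAddCommGroup G] [NormedSpace ℝ G] [NormedAddCommGroup P] [NormedSpace ℝ P]

lemma contDiff_bilinear (A : E →ₗ[ℝ] F →ₗ[ℝ] G) {X : P → E} {Y : P → F}
    (hX : ContDiff ℝ ∞ X) (hY : ContDiff ℝ ∞ Y) : ContDiff ℝ ∞ fun p => A (X p) (Y p) :=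
  (A.toContinuousBilinearMap.contDiff.comp hX).clm_apply hY

lemma hasDerivAt_bilinear (A : E →ₗ[ℝ] F →ₗ[ℝ] G) {X : ℝ → E} {Y : ℝ → F} {X' : E} {Y' : F}
    {t : ℝ} (hX : HasDerivAt X X' t) (hY : HasDerivAt Y Y' t) :
    HasDerivAt (fun s => A (X s) (Y s)) (A X' (Y t) + A (X t) Y') t :=
  (A.toContinuousBilinearMap.hasFDerivAt.comp_hasDerivAt t hX).clm_apply hY

end Bilinear

/-! ## Vector fields and functions on `M` -/

/-- The fundamental vector field of `A ∈ so(5)` (up to sign). -/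
def fundamental (A : Mat5) : VectorField :=
  ⟨fun g => proj ((g : Mat5)ᵀ * A * (g : Mat5)), by
    refine ⟨fun C => proj (Cᵀ * A * C), ?_, fun _ => rfl⟩
    have ht : ContDiff ℝ ∞ fun C : Mat5 => Cᵀ :=
      (LinearMap.toContinuousLinearMap
        (Matrix.transposeLinearEquiv (Fin 5) (Fin 5) ℝ ℝ).toLinearMap).contDiff
    exact (LinearMap.toContinuousLinearMap proj).contDiff.comp
      ((ht.mul contDiff_const).mul contDiff_id), fun g h => by
    rw [← proj_conj]
    refine congrArg proj ?_
    have e : (((h⁻¹ : H) : SO5) : Mat5) = ((h : SO5) : Mat5)ᵀ := rfl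
    have e' : ((g * (h : SO5) : SO5) : Mat5) = (g : Mat5) * ((h : SO5) : Mat5) := rfl
    rw [e, e', Matrix.transpose_mul, Matrix.transpose_transpose]
    simp only [Matrix.mul_assoc]⟩

/-- By homogeneity, fundamental fields span every tangent space. Pointwise identities can thus be
tested on global fields, with no cutoff functions. -/
lemma exists_vectorField_eq (g : SO5) (X : 𝔪) : ∃ V : VectorField, V.1 g = X := by
  refine ⟨fundamental ((g : Mat5) * (X : Mat5) * (g : Mat5)ᵀ), ?_⟩
  change proj ((g : Mat5)ᵀ * ((g : Mat5) * (X : Mat5) * (g : Mat5)ᵀ) * (g : Mat5)) = X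
  have e := coe_transpose_mul g
  have : (g : Mat5)ᵀ * ((g : Mat5) * (X : Mat5) * (g : Mat5)ᵀ) * (g : Mat5) =
      ((g : Mat5)ᵀ * (g : Mat5)) * (X : Mat5) * ((g : Mat5)ᵀ * (g : Mat5)) := by
    simp only [Matrix.mul_assoc]
  rw [this, e, Matrix.one_mul, Matrix.mul_one, proj_coe]

/-! ### Functions on `M` that detect tangent vectors -/

/-- The matrix `diag(0, 0, 1, 1, 2)`, whose centralizer in `SO(5)` contains `H`. -/
def blkMat : Mat5 := Matrix.diagonal fun i => ((blk i : ℕ) : ℝ)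

lemma H_mul_blkMat (h : H) : ((h : SO5) : Mat5) * blkMat = blkMat * ((h : SO5) : Mat5) := by
  ext i j
  rw [blkMat, Matrix.mul_diagonal, Matrix.diagonal_mul]
  by_cases hij : blk i = blk j
  · rw [hij, mul_comm]
  · rw [H_offDiag h i j hij, zero_mul, mul_zero]

lemma contDiff_conj_entry (i j : Fin 5) :
    ContDiff ℝ ∞ fun A : Mat5 => (A * blkMat * Aᵀ) i j := by
  have ht : ContDiff ℝ ∞ fun C : Mat5 => Cᵀ :=
    (LinearMap.toContinuousLinearMap
      (Matrix.transposeLinearEquiv (Fin 5) (Fin 5) ℝ ℝ).toLinearMap).contDiff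
  exact (LinearMap.toContinuousLinearMap (Matrix.entryLinearMap ℝ ℝ i j)).contDiff.comp
    ((contDiff_id.mul contDiff_const).mul ht)

/-- The smooth function `gH ↦ (g D gᵀ)_{ij}` on `M`, where `D = diag(0, 0, 1, 1, 2)`. -/
def conjEntry (i j : Fin 5) : SmoothFun :=
  ⟨Quotient.lift (fun g : SO5 => ((g : Mat5) * blkMat * (g : Mat5)ᵀ) i j) (by
    intro a b hab
    obtain ⟨h, rfl⟩ : ∃ h : H, b = a * (h : SO5) :=
      ⟨⟨a⁻¹ * b, QuotientGroup.leftRel_apply.1 hab⟩, by simp⟩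
    have e' : ((a * (h : SO5) : SO5) : Mat5) = (a : Mat5) * ((h : SO5) : Mat5) := rfl
    have key : (a : Mat5) * ((h : SO5) : Mat5) * blkMat *
        ((a : Mat5) * ((h : SO5) : Mat5))ᵀ = (a : Mat5) * blkMat * (a : Mat5)ᵀ := by
      rw [Matrix.transpose_mul, Matrix.mul_assoc (a : Mat5), H_mul_blkMat]
      calc _ = (a : Mat5) * blkMat * (((h : SO5) : Mat5) * ((h : SO5) : Mat5)ᵀ) *
            (a : Mat5)ᵀ := by simp only [Matrix.mul_assoc]
        _ = _ := by rw [coe_mul_transpose, Matrix.mul_one]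
    simp only [e', key]),
   ⟨fun A => (A * blkMat * Aᵀ) i j, contDiff_conj_entry i j, fun _ => rfl⟩⟩

lemma fderiv_conj_entry (i j : Fin 5) (A V : Mat5) :
    fderiv ℝ (fun A : Mat5 => (A * blkMat * Aᵀ) i j) A V =
      (A * blkMat * Vᵀ + V * blkMat * Aᵀ) i j := by
  have ht : HasFDerivAt (fun C : Mat5 => Cᵀ) (LinearMap.toContinuousLinearMap
      (Matrix.transposeLinearEquiv (Fin 5) (Fin 5) ℝ ℝ).toLinearMap) A :=
    (LinearMap.toContinuousLinearMap
      (Matrix.transposeLinearEquiv (Fin 5) (Fin 5) ℝ ℝ).toLinearMap).hasFDerivAt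
  have h1 := (((hasFDerivAt_id (𝕜 := ℝ) A).mul_const' blkMat).mul' ht)
  have h2 := (LinearMap.toContinuousLinearMap
    (Matrix.entryLinearMap ℝ ℝ i j)).hasFDerivAt.comp A h1
  have h3 : HasFDerivAt (fun A : Mat5 => (A * blkMat * Aᵀ) i j) _ A := h2
  rw [h3.fderiv]
  rfl

/-- A vector field is determined by its action on smooth functions. -/
lemma act_injective {V W : VectorField} (h : ∀ f, act V f = act W f) : V = W := by
  apply Subtype.ext
  funext g
  have expand : ∀ G U : Mat5, G * blkMat * (Uᵀ * Gᵀ) + G * U * blkMat * Gᵀ =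
      G * (blkMat * Uᵀ + U * blkMat) * Gᵀ := fun G U => by
    simp only [Matrix.mul_add, Matrix.add_mul, Matrix.mul_assoc]
  -- The map `gH ↦ g D gᵀ` sends `M` to an orbit of symmetric matrices; its derivative along `U` is
  -- `g (U D - D U) gᵀ`, because `U` is skew.
  have key : ∀ U : VectorField, ∀ i j, (act U (conjEntry i j)).1 (QuotientGroup.mk g) =
      ((g : Mat5) * (blkMat * (U.1 g : Mat5)ᵀ + (U.1 g : Mat5) * blkMat) * (g : Mat5)ᵀ) i j := by
    intro U i j
    change horDeriv U.1 (fun a : SO5 => (conjEntry i j).1 (QuotientGroup.mk a)) g = _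
    rw [horDeriv_eq (F := fun a : SO5 => (conjEntry i j).1 (QuotientGroup.mk a))
      (contDiff_conj_entry i j) (fun _ => rfl), fderiv_conj_entry, Matrix.transpose_mul]
    exact congrFun (congrFun (expand _ _) i) j
  have hconj : (g : Mat5) * (blkMat * (V.1 g : Mat5)ᵀ + (V.1 g : Mat5) * blkMat) * (g : Mat5)ᵀ =
      (g : Mat5) * (blkMat * (W.1 g : Mat5)ᵀ + (W.1 g : Mat5) * blkMat) * (g : Mat5)ᵀ := by
    ext i j
    rw [← key, ← key, h]
  have hcancel : ∀ A : Mat5, (g : Mat5)ᵀ * ((g : Mat5) * A * (g : Mat5)ᵀ) * (g : Mat5) = A := by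
    intro A
    calc _ = ((g : Mat5)ᵀ * (g : Mat5)) * A * ((g : Mat5)ᵀ * (g : Mat5)) := by
          simp only [Matrix.mul_assoc]
      _ = A := by rw [coe_transpose_mul, Matrix.one_mul, Matrix.mul_one]
  have heq := congrArg (fun A => (g : Mat5)ᵀ * A * (g : Mat5)) hconj
  simp only [hcancel] at heq
  rw [(V.1 g).2.1, (W.1 g).2.1] at heq
  ext i j
  by_cases hij : blk i = blk j
  · rw [(V.1 g).2.2 i j hij, (W.1 g).2.2 i j hij]
  · have hentry := congrFun (congrFun heq i) j
    simp only [blkMat, Matrix.add_apply, Matrix.diagonal_mul, Matrix.mul_diagonal,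
      Matrix.neg_apply] at hentry
    -- The `(i, j)` entry of `U D - D U` is `(d_j - d_i) U_ij`. Since `D` has distinct eigenvalues
    -- on distinct blocks, `U` is recovered.
    have hne : ((blk j : ℕ) : ℝ) - ((blk i : ℕ) : ℝ) ≠ 0 := by
      rw [sub_ne_zero]
      exact fun e => hij (Fin.ext (Nat.cast_injective e)).symm
    exact mul_left_cancel₀ hne (by linarith)

lemma act_apply (V : VectorField) (f : SmoothFun) (g : SO5) :
    (act V f).1 (QuotientGroup.mk g) = horDeriv V.1 (fun a => f.1 (QuotientGroup.mk a)) g := rfl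

lemma act_add (V W : VectorField) (f : SmoothFun) : act (V + W) f = act V f + act W f := by
  apply Subtype.ext
  funext q
  induction q using QuotientGroup.induction_on with
  | H g =>
    obtain ⟨f', hf1, hf2⟩ := f.2
    change (act (V + W) f).1 (QuotientGroup.mk g) =
      (act V f).1 (QuotientGroup.mk g) + (act W f).1 (QuotientGroup.mk g)
    simp only [act_apply, horDeriv_eq hf1 hf2]
    change fderiv ℝ f' g ((g : Mat5) * ((V.1 g + W.1 g : 𝔪) : Mat5)) = _
    rw [Submodule.coe_add, mul_add, map_add]

/-- The action of vector fields on a smooth function, as an additive map. -/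
def actHom (f : SmoothFun) : VectorField →+ SmoothFun :=
  AddMonoidHom.mk' (fun V => act V f) fun V W => act_add V W f

lemma act_sub (V W : VectorField) (f : SmoothFun) : act (V - W) f = act V f - act W f :=
  map_sub (actHom f) V W

lemma act_zero (f : SmoothFun) : act 0 f = 0 := map_zero (actHom f)

/-! ## Torsion and metric connections -/

/-- A connection is torsion-free if and only if its torsion differs from that of the canonical
connection in the expected way. -/
lemma AffineConnection.isTorsion_zero_iff (D : AffineConnection) :
    D.IsTorsion (fun _ _ => 0) ↔ ∀ X Y, D.cov X Y - D.cov Y X =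
      canonical.cov X Y - canonical.cov Y X - canonicalTorsion X Y := by
  constructor
  · intro h X Y
    refine act_injective fun f => ?_
    have h1 := h X Y f
    have h2 := canonical_isTorsion X Y f
    rw [act_zero] at h1
    rw [act_sub, act_sub, act_sub, h2]
    linear_combination -h1
  · intro h X Y f
    have h1 := congrArg (fun V => act V f) (h X Y)
    have h2 := canonical_isTorsion X Y f
    simp only [act_sub] at h1
    rw [act_zero]
    linear_combination -h1 + h2

/-- The canonical connection is metric. -/
lemma InvariantMetric.act_inner (g : InvariantMetric) (X Y Z : VectorField) :
    act X (g.inner Y Z) = g.inner (canonical.cov X Y) Z + g.inner Y (canonical.cov X Z) := by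
  apply Subtype.ext
  funext q
  induction q using QuotientGroup.induction_on with
  | H a =>
    obtain ⟨Y', hY1, hY2⟩ := Y.2.1
    obtain ⟨Z', hZ1, hZ2⟩ := Z.2.1
    change deriv (fun t : ℝ => g.B (Y.1 (a * expSO (t • X.1 a))) (Z.1 (a * expSO (t • X.1 a)))) 0 =
      g.B (horDeriv X.1 Y.1 a) (Z.1 a) + g.B (Y.1 a) (horDeriv X.1 Z.1 a)
    have h1 := hasDerivAt_hor hY1 hY2 a (X.1 a)
    have h2 := hasDerivAt_hor hZ1 hZ2 a (X.1 a)
    have e : expSO 0 = 1 := Subtype.ext (by simp [expSO])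
    -- The form `B` does not depend on the point, so the product rule yields only the two terms in
    -- which a field is differentiated.
    have h3 := hasDerivAt_bilinear g.B h1 h2
    rw [horDeriv, horDeriv, h1.deriv, h2.deriv]
    refine h3.deriv.trans ?_
    simp only [zero_smul, e, mul_one]

/-! ### Connections differing from the canonical one by an invariant tensor -/

lemma isSmooth_bilinear {E F G : Type} [NormedAddCommGroup E] [NormedSpace ℝ E]
    [FiniteDimensional ℝ E] [NormedAddCommGroup F] [NormedSpace ℝ F] [FiniteDimensional ℝ F]
    [NormedAddCommGroup G] [NormedSpace ℝ G] (A : E →ₗ[ℝ] F →ₗ[ℝ] G) {X : SO5 → E} {Y : SO5 → F}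
    (hX : IsSmooth X) (hY : IsSmooth Y) : IsSmooth fun g => A (X g) (Y g) := by
  obtain ⟨X', hX1, hX2⟩ := hX
  obtain ⟨Y', hY1, hY2⟩ := hY
  exact ⟨fun C => A (X' C) (Y' C), contDiff_bilinear A hX1 hY1, fun a => by simp only [hX2, hY2]⟩

/-- The vector field `A(X, Y)`, for an `Ad(H)`-equivariant bilinear map `A` on `𝔪`. -/
def tensorField (A : 𝔪 →ₗ[ℝ] 𝔪 →ₗ[ℝ] 𝔪)
    (hA : ∀ (h : H) X Y, A (Ad h X) (Ad h Y) = Ad h (A X Y)) (X Y : VectorField) : VectorField :=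
  ⟨fun g => A (X.1 g) (Y.1 g),
    isSmooth_bilinear (E := 𝔪) (F := 𝔪) (G := 𝔪) A X.2.1 Y.2.1,
    fun g h => by simp only [X.2.2, Y.2.2, hA]⟩

/-- The connection `∇ + A`, where `∇` is the canonical connection and `A` is an `Ad(H)`-equivariant
bilinear map on `𝔪`. -/
def invariantConnection (A : 𝔪 →ₗ[ℝ] 𝔪 →ₗ[ℝ] 𝔪)
    (hA : ∀ (h : H) X Y, A (Ad h X) (Ad h Y) = Ad h (A X Y)) : AffineConnection where
  cov X Y := canonical.cov X Y + tensorField A hA X Y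
  add_left X X' Y := by
    rw [canonical.add_left]
    apply Subtype.ext
    funext g
    simp [tensorField]
    abel
  smul_left f X Y := by
    rw [canonical.smul_left]
    apply Subtype.ext
    funext g
    simp [fmul, tensorField]
  add_right X Y Y' := by
    rw [canonical.add_right]
    apply Subtype.ext
    funext g
    simp [tensorField]
    abel
  leibniz X f Y := by
    rw [canonical.leibniz]
    apply Subtype.ext
    funext g
    simp [fmul, tensorField]
    abel

lemma invariantConnection_apply (A : 𝔪 →ₗ[ℝ] 𝔪 →ₗ[ℝ] 𝔪)
    (hA : ∀ (h : H) X Y, A (Ad h X) (Ad h Y) = Ad h (A X Y)) (X Y : VectorField) (a : SO5) :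
    ((invariantConnection A hA).cov X Y).1 a = (canonical.cov X Y).1 a + A (X.1 a) (Y.1 a) := rfl

lemma canonicalTorsionFree_apply (X Y : VectorField) (a : SO5) :
    (canonicalTorsionFree.cov X Y).1 a =
      (canonical.cov X Y).1 a + (1 / 2 : ℝ) • bracketM (X.1 a) (Y.1 a) := by
  change (canonical.cov X Y).1 a - (1 / 2 : ℝ) • -bracketM (X.1 a) (Y.1 a) = _
  rw [smul_neg, sub_neg_eq_add]

/-- Both connections are `∇` plus a tensor, and fields with prescribed values at the origin allow
the two tensors to be compared there. -/
lemma invariantConnection_eq_canonicalTorsionFree_iff (A : 𝔪 →ₗ[ℝ] 𝔪 →ₗ[ℝ] 𝔪)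
    (hA : ∀ (h : H) X Y, A (Ad h X) (Ad h Y) = Ad h (A X Y)) :
    invariantConnection A hA = canonicalTorsionFree ↔
      ∀ X Y, A X Y = (1 / 2 : ℝ) • bracketM X Y := by
  constructor
  · intro h X Y
    obtain ⟨V, rfl⟩ := exists_vectorField_eq 1 X
    obtain ⟨W, rfl⟩ := exists_vectorField_eq 1 Y
    have h1 := congrArg (fun D : AffineConnection => (D.cov V W).1 1) h
    simp only [invariantConnection_apply, canonicalTorsionFree_apply] at h1
    exact add_left_cancel h1
  · intro h
    ext1
    funext X Y
    apply Subtype.ext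
    funext a
    rw [invariantConnection_apply, canonicalTorsionFree_apply, h]

/-! ## The Levi-Civita connection -/

lemma InvariantMetric.ext_left (g : InvariantMetric) {X Y : 𝔪}
    (h : ∀ Z, g.B X Z = g.B Y Z) : X = Y :=
  sub_eq_zero.1 (g.nondegenerate _ fun Z => by
    rw [map_sub, LinearMap.sub_apply, h, sub_self])

lemma bracketM_swap (X Y : 𝔪) : bracketM X Y = -bracketM Y X := by
  rw [bracketM, bracketM, ← map_neg, neg_sub]

/-- The Koszul formula on `𝔪`. -/
lemma InvariantMetric.exists_koszul (g : InvariantMetric) :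
    ∃ A : 𝔪 →ₗ[ℝ] 𝔪 →ₗ[ℝ] 𝔪, ∀ X Y Z, 2 * g.B (A X Y) Z =
      g.B (bracketM X Y) Z + (g.B X (bracketM Z Y) + g.B (bracketM Z X) Y) := by
  have hnd : g.B.Nondegenerate :=
    ⟨g.nondegenerate, fun Y h => g.nondegenerate Y fun X => by rw [g.symm, h]⟩
  have hex : ∀ X Y, ∃ V, ∀ Z, 2 * g.B V Z =
      g.B (bracketM X Y) Z + (g.B X (bracketM Z Y) + g.B (bracketM Z X) Y) := by
    intro X Y
    let φ : Module.Dual ℝ 𝔪 :=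
      { toFun := fun Z => (1 / 2 : ℝ) * (g.B (bracketM X Y) Z +
          (g.B X (bracketM Z Y) + g.B (bracketM Z X) Y))
        map_add' := fun Z Z' => by
          simp only [bracketM_add_left, map_add, LinearMap.add_apply]
          ring
        map_smul' := fun c Z => by
          simp only [bracketM_smul_left, map_smul, LinearMap.smul_apply, smul_eq_mul,
            RingHom.id_apply]
          ring }
    -- The right-hand side is linear in `Z`, so nondegeneracy represents it by a vector;
    -- definiteness plays no role.
    refine ⟨(g.B.toDual hnd).symm φ, fun Z => ?_⟩
    rw [LinearMap.BilinForm.apply_toDual_symm_apply]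
    change 2 * ((1 / 2 : ℝ) * _) = _
    ring
  -- The chosen vector is determined by its pairings, so its bilinearity in `X, Y` is inherited from
  -- the right-hand side.
  choose F hF using hex
  refine ⟨LinearMap.mk₂ ℝ F ?_ ?_ ?_ ?_, fun X Y Z => by rw [LinearMap.mk₂_apply, hF]⟩
  · intro X X' Y
    refine g.ext_left fun Z => ?_
    have h := hF (X + X') Y Z
    have h1 := hF X Y Z
    have h2 := hF X' Y Z
    simp only [bracketM_add_left, bracketM_add_right, map_add, LinearMap.add_apply] at h h1 h2 ⊢
    linarith
  · intro c X Y
    refine g.ext_left fun Z => ?_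
    have h := hF (c • X) Y Z
    have h1 := hF X Y Z
    simp only [bracketM_smul_left, bracketM_smul_right, map_smul, LinearMap.smul_apply,
      smul_eq_mul] at h h1 ⊢
    linear_combination h / 2 - c * h1 / 2
  · intro X Y Y'
    refine g.ext_left fun Z => ?_
    have h := hF X (Y + Y') Z
    have h1 := hF X Y Z
    have h2 := hF X Y' Z
    simp only [bracketM_add_right, map_add, LinearMap.add_apply] at h h1 h2 ⊢
    linarith
  · intro c X Y
    refine g.ext_left fun Z => ?_
    have h := hF X (c • Y) Z
    have h1 := hF X Y Z
    simp only [bracketM_smul_right, map_smul, LinearMap.smul_apply,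
      smul_eq_mul] at h h1 ⊢
    linear_combination h / 2 - c * h1 / 2

lemma Ad_Ad_inv (h : H) (X : 𝔪) : Ad h (Ad h⁻¹ X) = X := by
  apply Subtype.ext
  rw [coe_Ad, coe_Ad]
  have e : (((h⁻¹ : H) : SO5) : Mat5) = ((h : SO5) : Mat5)ᵀ := rfl
  rw [e, Matrix.transpose_transpose]
  calc _ = ((h : SO5) : Mat5) * ((h : SO5) : Mat5)ᵀ * (X : Mat5) *
        (((h : SO5) : Mat5) * ((h : SO5) : Mat5)ᵀ) := by simp only [Matrix.mul_assoc]
    _ = _ := by rw [coe_mul_transpose, Matrix.one_mul, Matrix.mul_one]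

/-- The Koszul expression is built from `B` and `[·,·]_𝔪`, both compatible with `Ad(H)`, so the
tensor it determines is too. This is what lets `A` act on vector fields of `M`. -/
lemma InvariantMetric.koszul_equivariant (g : InvariantMetric) {A : 𝔪 →ₗ[ℝ] 𝔪 →ₗ[ℝ] 𝔪}
    (hA : ∀ X Y Z, 2 * g.B (A X Y) Z =
      g.B (bracketM X Y) Z + (g.B X (bracketM Z Y) + g.B (bracketM Z X) Y))
    (h : H) (X Y : 𝔪) : A (Ad h X) (Ad h Y) = Ad h (A X Y) := by
  refine g.ext_left fun Z => ?_
  obtain ⟨W, rfl⟩ : ∃ W, Z = Ad h W := ⟨_, (Ad_Ad_inv h Z).symm⟩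
  have h1 := hA (Ad h X) (Ad h Y) (Ad h W)
  have h2 := hA X Y W
  simp only [bracketM_Ad, g.invariant] at h1 ⊢
  linarith

/-- In Koszul's formula the last two terms together are symmetric in `X, Y`, so antisymmetrizing
leaves the bracket and cancels the torsion of `∇`. Exchanging `Y` and `Z` reverses the sign of the
whole expression, so `A(X, ·)` is `B`-skew and the metric stays parallel. -/
lemma InvariantMetric.isLeviCivita_koszul (g : InvariantMetric) {A : 𝔪 →ₗ[ℝ] 𝔪 →ₗ[ℝ] 𝔪}
    (hA : ∀ X Y Z, 2 * g.B (A X Y) Z =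
      g.B (bracketM X Y) Z + (g.B X (bracketM Z Y) + g.B (bracketM Z X) Y)) :
    g.IsLeviCivita (invariantConnection A (g.koszul_equivariant hA)) := by
  constructor
  · rw [AffineConnection.isTorsion_zero_iff]
    intro X Y
    apply Subtype.ext
    funext a
    have key : A (X.1 a) (Y.1 a) - A (Y.1 a) (X.1 a) = bracketM (X.1 a) (Y.1 a) := by
      refine g.ext_left fun Z => ?_
      have h1 := hA (X.1 a) (Y.1 a) Z
      have h2 := hA (Y.1 a) (X.1 a) Z
      rw [bracketM_swap (Y.1 a) (X.1 a), g.symm (Y.1 a), g.symm (bracketM Z (Y.1 a))] at h2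
      simp only [map_neg, map_sub, LinearMap.sub_apply, LinearMap.neg_apply] at h2 ⊢
      linarith
    change (canonical.cov X Y).1 a + A (X.1 a) (Y.1 a) -
        ((canonical.cov Y X).1 a + A (Y.1 a) (X.1 a)) =
      (canonical.cov X Y).1 a - (canonical.cov Y X).1 a - -bracketM (X.1 a) (Y.1 a)
    rw [← key]
    abel
  · intro X Y Z
    rw [g.act_inner]
    apply Subtype.ext
    funext q
    induction q using QuotientGroup.induction_on with
    | H a =>
      change g.B ((canonical.cov X Y).1 a) (Z.1 a) + g.B (Y.1 a) ((canonical.cov X Z).1 a) =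
        g.B ((canonical.cov X Y).1 a + A (X.1 a) (Y.1 a)) (Z.1 a) +
          g.B (Y.1 a) ((canonical.cov X Z).1 a + A (X.1 a) (Z.1 a))
      have h1 := hA (X.1 a) (Y.1 a) (Z.1 a)
      have h2 := hA (X.1 a) (Z.1 a) (Y.1 a)
      rw [bracketM_swap (Y.1 a) (Z.1 a), bracketM_swap (Y.1 a) (X.1 a),
        bracketM_swap (X.1 a) (Z.1 a), g.symm (A (X.1 a) (Z.1 a))] at h2
      rw [g.symm (bracketM (Z.1 a) (X.1 a))] at h1
      simp only [map_neg, map_add, LinearMap.add_apply, LinearMap.neg_apply] at h1 h2 ⊢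
      rw [g.symm (bracketM (Z.1 a) (X.1 a))] at h2
      linarith

/-- Uniqueness of the Levi-Civita connection. -/
lemma InvariantMetric.isLeviCivita_unique (g : InvariantMetric) {D D' : AffineConnection}
    (hD : g.IsLeviCivita D) (hD' : g.IsLeviCivita D') : D = D' := by
  ext1
  funext X Y
  apply Subtype.ext
  funext a
  -- The difference is kept as a function of fields: symmetry and skewness hold at the point `a`
  -- without first proving that it is tensorial.
  let S : VectorField → VectorField → 𝔪 := fun X Y => (D.cov X Y).1 a - (D'.cov X Y).1 a
  have hsymm : ∀ X Y, S X Y = S Y X := by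
    intro X Y
    have h1 := (D.isTorsion_zero_iff.1 hD.1 X Y).trans (D'.isTorsion_zero_iff.1 hD'.1 X Y).symm
    have h2 : (D.cov X Y).1 a - (D.cov Y X).1 a = (D'.cov X Y).1 a - (D'.cov Y X).1 a :=
      congrArg (fun V : VectorField => V.1 a) h1
    change (D.cov X Y).1 a - (D'.cov X Y).1 a = (D.cov Y X).1 a - (D'.cov Y X).1 a
    rw [sub_eq_sub_iff_add_eq_add] at h2 ⊢
    rw [h2, add_comm]
  have hskew : ∀ X Y Z : VectorField, g.B (S X Y) (Z.1 a) = -g.B (S X Z) (Y.1 a) := by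
    intro X Y Z
    have h1 : g.B ((D.cov X Y).1 a) (Z.1 a) + g.B (Y.1 a) ((D.cov X Z).1 a) =
        g.B ((D'.cov X Y).1 a) (Z.1 a) + g.B (Y.1 a) ((D'.cov X Z).1 a) :=
      congrArg (fun f : SmoothFun => f.1 (QuotientGroup.mk a))
        ((hD.2 X Y Z).symm.trans (hD'.2 X Y Z))
    rw [g.symm (Y.1 a), g.symm (Y.1 a)] at h1
    simp only [S, map_sub, LinearMap.sub_apply]
    linarith
  refine g.ext_left fun Z => ?_
  obtain ⟨W, rfl⟩ := exists_vectorField_eq a Z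
  -- Alternating three skew and three symmetric exchanges returns to the starting expression with
  -- the opposite sign.
  have hzero : g.B (S X Y) (W.1 a) = 0 := by
    have h1 := hskew X Y W
    rw [hsymm X W, hskew W X Y, hsymm W Y, hskew Y W X, hsymm Y X] at h1
    linarith
  simp only [S, map_sub, LinearMap.sub_apply] at hzero
  linarith

/-- The Levi-Civita connection exists and is unique, and it is the torsion-free canonical
connection if and only if the metric is naturally reductive. -/
lemma InvariantMetric.exists_leviCivita (g : InvariantMetric) :
    ∃ D : AffineConnection, (∀ D', g.IsLeviCivita D' ↔ D' = D) ∧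
      (D = canonicalTorsionFree ↔ g.IsNaturallyReductive) := by
  obtain ⟨A, hA⟩ := g.exists_koszul
  have hLC := g.isLeviCivita_koszul hA
  refine ⟨_, fun D' => ⟨fun h => g.isLeviCivita_unique h hLC, fun h => h ▸ hLC⟩, ?_⟩
  -- With `A = ½[·,·]_𝔪` the left side of Koszul's formula cancels its first bracket term, leaving
  -- exactly the natural reductivity identity.
  rw [invariantConnection_eq_canonicalTorsionFree_iff]
  constructor
  · intro h X Y Z
    have h1 := hA X Y Z
    rw [h, map_smul, LinearMap.smul_apply, smul_eq_mul] at h1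
    linarith
  · intro h X Y
    refine g.ext_left fun Z => ?_
    have h1 := hA X Y Z
    rw [h X Y Z] at h1
    rw [map_smul, LinearMap.smul_apply, smul_eq_mul]
    linarith

end

end FlagSO5

/-! ### The main theorem -/

theorem mainTheorem4 (g : FlagSO5.InvariantMetric) (horth : g.OrthogonalComponents) :
    ∃ D : FlagSO5.AffineConnection,
      (∀ D' : FlagSO5.AffineConnection, g.IsLeviCivita D' ↔ D' = D) ∧
      (D = FlagSO5.canonicalTorsionFree ↔
        ∃ c : ℝ, c ≠ 0 ∧ ∀ X, g.B X X = c * FlagSO5.sumSq X) ∧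
      (g.IsRiemannian →
        (D = FlagSO5.canonicalTorsionFree ↔
          ∃ c : ℝ, 0 < c ∧ ∀ X, g.B X X = c * FlagSO5.sumSq X)) ∧
      ∃ t u v w : ℝ,
        (∀ X, g.B X X = t * ∑ i, FlagSO5.α i X ^ 2
          + u * (FlagSO5.α 0 X * FlagSO5.α 3 X - FlagSO5.α 1 X * FlagSO5.α 2 X)
          + v * ∑ i, FlagSO5.β i X ^ 2 + w * ∑ i, FlagSO5.γ i X ^ 2) ∧
        (g.IsNaturallyReductive ↔ u = 0 ∧ t = v ∧ v = w) ∧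
        (D = FlagSO5.canonicalTorsionFree ↔ u = 0 ∧ t = v ∧ v = w) := by
  obtain ⟨D, hLC, hD⟩ := g.exists_leviCivita
  obtain ⟨t, u, v, w, hB⟩ := g.exists_coeff horth
  have hred := g.isNaturallyReductive_iff hB
  have hquad : ∀ X, g.B X X = t * ∑ i, FlagSO5.α i X ^ 2
      + u * (FlagSO5.α 0 X * FlagSO5.α 3 X - FlagSO5.α 1 X * FlagSO5.α 2 X)
      + v * ∑ i, FlagSO5.β i X ^ 2 + w * ∑ i, FlagSO5.γ i X ^ 2 := by
    intro X
    conv_lhs => rw [FlagSO5.eq_mkM X, hB]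
    simp only [Fin.sum_univ_four, Fin.sum_univ_two]
    ring
  have hscalar : ∀ c : ℝ, (∀ X, g.B X X = c * FlagSO5.sumSq X) → u = 0 ∧ t = v ∧ v = w := by
    intro c hc
    -- These vectors give `t = c`, `2t + u = 2c`, `v = c` and `w = c`. The second one, `A₁ + A₄`, is
    -- needed because `u` is invisible on the coordinate axes.
    have h₁ := hc (FlagSO5.mkM 1 0 0 0 0 0 0 0)
    have h₂ := hc (FlagSO5.mkM 1 0 0 1 0 0 0 0)
    have h₃ := hc (FlagSO5.mkM 0 0 0 0 1 0 0 0)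
    have h₄ := hc (FlagSO5.mkM 0 0 0 0 0 0 1 0)
    rw [hB] at h₁ h₂ h₃ h₄
    simp [FlagSO5.sumSq, FlagSO5.α, FlagSO5.β, FlagSO5.γ, FlagSO5.mkM, Fin.sum_univ_succ]
      at h₁ h₂ h₃ h₄
    exact ⟨by linarith, by linarith, by linarith⟩
  have ht : u = 0 ∧ t = v ∧ v = w → ∀ X, g.B X X = t * FlagSO5.sumSq X := by
    rintro ⟨rfl, rfl, rfl⟩ X
    rw [hquad, FlagSO5.sumSq]
    ring
  have hunit : g.B (FlagSO5.mkM 1 0 0 0 0 0 0 0) (FlagSO5.mkM 1 0 0 0 0 0 0 0) = t := by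
    rw [hB]
    ring
  have hne : FlagSO5.mkM 1 0 0 0 0 0 0 0 ≠ 0 := by
    intro h
    simpa [FlagSO5.α, FlagSO5.mkM] using congrArg (FlagSO5.α 0) h
  refine ⟨D, hLC, ?_, fun hpos => ?_, t, u, v, w, hquad, hred, hD.trans hred⟩
  · rw [hD, hred]
    refine ⟨fun h => ⟨t, ?_, ht h⟩, fun ⟨c, _, hc⟩ => hscalar c hc⟩
    obtain ⟨rfl, rfl, rfl⟩ := h
    rintro rfl
    -- If the common coefficient were zero, `A₁` would be a nonzero vector in the radical of `B`.
    refine hne (g.nondegenerate _ fun Y => ?_)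
    rw [FlagSO5.eq_mkM Y, hB]
    ring
  · rw [hD, hred]
    -- Here `t` is the squared length of `A₁`, hence positive.
    exact ⟨fun h => ⟨t, hunit ▸ hpos _ hne, ht h⟩, fun ⟨c, _, hc⟩ => hscalar c hc⟩
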